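/- Fix countably infinite sets of participants $p,q,r,\dots$ and labels $\ell$. \emph{Processes} are the regular (finitely many distinct subterms), possibly infinite terms $P ::= \mathbf 0 \mid \bigoplus_{i\in I} q_i!\ell_i;P_i \mid \sum_{i\in I} q_i?\ell_i;P_i$, and \emph{global types} are the regular, possibly infinite terms $G ::= \mathsf{End}\mid p!\{q_i.\ell_i;G_i\}_{i\in I}\mid p?\{q_i.\ell_i;G_i\}_{i\in I}$, where $I$ is finite and nonempty, the pairs $(q_i,\ell_i)$ are pairwise distinct and, in global types, $p\ne q_i$. $\mathrm{players}(G)$ is the set of the participants $p$ that head some choice occurring in $G$. Global types are required to be \emph{bounded}: for each $p\in\mathrm{players}(G)$ and each $G'$ occurring in $G$ with $p\in\mathrm{players}(G')$, there is a finite bound on the position of the first communication with player $p$ over all (finite or infinite) paths of $G'$; in particular $p$ is a player on every such path. A \emph{session} $N\parallel M$ consists of a network $N$ assigning a process to each participant, with $N(p)=\mathbf 0$ for all but finitely many $p$, and a queue $M$, that is, a finite sequence of messages $\langle p,\ell,q\rangle$ (sender, label, receiver). Queues are taken modulo the equivalence $\equiv$ generated by swapping adjacent messages that differ in the sender or in the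 receiver. Let $\mathrm{players}(N)=\{p\mid N(p)\neq\mathbf 0\}$ and let $N[p\mapsto P]$ be $N$ with the process of $p$ replaced by $P$. $G$ is \emph{inactive} for a set $\mathbb M$ of messages if no output occurring in $G$ produces a message of $\mathbb M$. The judgement $\vdash G: N\parallel M$ is defined coinductively (derivations may be infinite) by the following rules. \begin{itemize} \item $\vdash \mathsf{End}: N\parallel\emptyset$ if $N(p)=\mathbf 0$ for all $p$. \item $\vdash p!\{q_i.\ell_i;G_i\}_{i\in I}: N\parallel M$ if $N(p)=\bigoplus_{i\in I}q_i!\ell_i;P_i$ and, for all $i\in I$, $\vdash G_i: N[p\mapsto P_i]\parallel M\cdot\langle p,\ell_i,q_i\rangle$ and $\mathrm{players}(G_i)\setminus\{p\}=\mathrm{players}(N)\setminus\{p\}$. \item $\vdash p?\{q_i.\ell_i;G_i\}_{i\in I}: N\parallel M$ if $N(p)=\sum_{h\in H}q_h?\ell_h;P_h$; the live branches of both choices are the same, i.e. $J=\{i\in I\mid \exists M'.\ M\equiv\langle q_i,\ell_i,p\rangle\cdot M'\}=\{h\in H\mid \exists M'.\ M\equiv\langle q_h,\ell_h,p\rangle\cdot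 M'\}\neq\emptyset$; for all $j\in J$, $\vdash G_j:N[p\mapsto P_j]\parallel M_j$ where $M\equiv\langle q_j,\ell_j,p\rangle\cdot M_j$, and $G_j$ is inactive for $\{\langle q_l,\ell_l,p\rangle\mid l\in(I\cup H)\setminus J,\ q_l\ne q_j\ \forall j\in J\}$; and $\mathrm{players}(G_i)\setminus\{p\}=\mathrm{players}(N)\setminus\{p\}$ for all $i\in I$. (Branches are indexed by their pairs (sender, label).) \end{itemize} A session is \emph{typable} if $\vdash G:N\parallel M$ for some global type $G$. \textbf{Theorem (Undecidability).} Typing is undecidable. That is, with regular terms given as finite systems of equations: (1) no algorithm decides, given a session $N\parallel M$, whether it is typable; and (2) no algorithm decides, given a global type $G$ and a session $N\parallel M$, whether $\vdash G:N\parallel M$. -/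

import Mathlib

namespace AsyncSession

/-! ## Base sets, messages, queues -/

/-- Participants: a countably infinite set of names. -/
abbrev Part := ℕ

/-- Labels: a countably infinite set of names. -/
abbrev Lab := ℕ

/-- A message `(p, ℓ, q)`: label `ℓ` sent by `p` to `q`. -/
abbrev Message := Part × Lab × Part

/-- Message queues, the first message to be read coming first. -/
abbrev Queue := List Message

/-- Structural equivalence of queues: the equivalence generated by swapping two adjacent
messages that differ in the sender or in the receiver. -/
inductive QueueEquiv : Queue → Queue → Prop
  | swap (M M' : Queue) (m n : Message) (h : m.1 ≠ n.1 ∨ m.2.2 ≠ n.2.2) :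
      QueueEquiv (M ++ m :: n :: M') (M ++ n :: m :: M')
  | refl (M : Queue) : QueueEquiv M M
  | symm {M M' : Queue} : QueueEquiv M M' → QueueEquiv M' M
  | trans {M M' M'' : Queue} : QueueEquiv M M' → QueueEquiv M' M'' → QueueEquiv M M''

/-- The message `m` can be brought to the top of the queue `M`. -/
def Ready (m : Message) (M : Queue) : Prop := ∃ M' : Queue, QueueEquiv M (m :: M')

/-! ## Possibly infinite trees and regularity -/

/-- `s` is an immediate subterm of the possibly infinite tree `t`. -/
def IsChild {F : PFunctor.{0, 0}} (s t : F.M) : Prop := ∃ b, (PFunctor.M.dest t).2 b = s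

/-- `s` is a subterm of (occurs in) the possibly infinite tree `t`, possibly `t` itself. -/
def Subterm {F : PFunctor.{0, 0}} (s t : F.M) : Prop := Relation.ReflTransGen IsChild s t

/-- A tree is regular if it has finitely many distinct subterms. -/
def Regular {F : PFunctor.{0, 0}} (t : F.M) : Prop := {s : F.M | Subterm s t}.Finite

/-! ## Processes -/

/-- The branches of a choice are indexed by the pairs (participant, label) themselves; the
requirement that these pairs are pairwise distinct is thus built in. -/
abbrev Branches := Finset (Part × Lab)

/-- Root of a process: termination, output choice, input choice (over a nonempty index set). -/
inductive ProcShape : Type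
  | nil : ProcShape
  | out (I : Branches) (hI : I.Nonempty) : ProcShape
  | inp (I : Branches) (hI : I.Nonempty) : ProcShape

/-- The signature of processes. -/
abbrev procF : PFunctor.{0, 0} where
  A := ProcShape
  B := fun s => match s with
    | .nil => Empty
    | .out I _ => I
    | .inp I _ => I

/-- Possibly infinite process terms (final coalgebra of the signature). -/
abbrev Proc := procF.M

/-- The terminated process. -/
def Proc.nil : Proc := PFunctor.M.mk (F := procF) ⟨ProcShape.nil, fun b => Empty.elim b⟩

/-- Internal choice: for each `(q, ℓ) ∈ I`, send `ℓ` to `q` and continue as `P (q, ℓ)`. -/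
def Proc.out (I : Branches) (hI : I.Nonempty) (P : I → Proc) : Proc :=
  PFunctor.M.mk (F := procF) ⟨ProcShape.out I hI, P⟩

/-- External choice: for each `(q, ℓ) ∈ I`, receive `ℓ` from `q` and continue as `P (q, ℓ)`. -/
def Proc.inp (I : Branches) (hI : I.Nonempty) (P : I → Proc) : Proc :=
  PFunctor.M.mk (F := procF) ⟨ProcShape.inp I hI, P⟩

/-! ## Networks and sessions -/

/-- Networks up to structural congruence: each participant has a process, which is the
terminated one if the participant is not mentioned. -/
abbrev Net := Part → Proc

/-- The players of a network: the participants with a non-terminated process. -/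
def netPlayers (N : Net) : Set Part := {p | N p ≠ Proc.nil}

/-- A session: a network with finitely many non-terminated participants, all of whose
processes are regular, in parallel with a queue. -/
structure Session where
  net : Net
  queue : Queue
  finite_players : (netPlayers net).Finite
  regular : ∀ p, Regular (net p)

/-! ## Global types -/

/-- Root of a global type: `End`, or an output (input) choice of a player `p` over a nonempty
index set of pairs (partner, label) with all partners different from `p`. -/
inductive GShape : Type
  | nil : GShape
  | out (p : Part) (I : Branches) (hI : I.Nonempty) (hp : ∀ x ∈ I, p ≠ x.1) : GShape
  | inp (p : Part) (I : Branches) (hI : I.Nonempty) (hp : ∀ x ∈ I, p ≠ x.1) : GShape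

/-- The signature of global types. -/
abbrev globalF : PFunctor.{0, 0} where
  A := GShape
  B := fun s => match s with
    | .nil => Empty
    | .out _ I _ _ => I
    | .inp _ I _ _ => I

/-- Possibly infinite global type terms (final coalgebra of the signature). -/
abbrev GType := globalF.M

/-- The global type `End`. -/
def GType.nil : GType := PFunctor.M.mk (F := globalF) ⟨GShape.nil, fun b => Empty.elim b⟩

/-- `p` sends `ℓ` to `q` for some `(q, ℓ) ∈ I`, then the interaction is `G (q, ℓ)`. -/
def GType.out (p : Part) (I : Branches) (hI : I.Nonempty) (hp : ∀ x ∈ I, p ≠ x.1)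
    (G : I → GType) : GType :=
  PFunctor.M.mk (F := globalF) ⟨GShape.out p I hI hp, G⟩

/-- `p` receives `ℓ` from `q` for some `(q, ℓ) ∈ I`, then the interaction is `G (q, ℓ)`. -/
def GType.inp (p : Part) (I : Branches) (hI : I.Nonempty) (hp : ∀ x ∈ I, p ≠ x.1)
    (G : I → GType) : GType :=
  PFunctor.M.mk (F := globalF) ⟨GShape.inp p I hI hp, G⟩

/-- `IsPlayer r T`: the participant `r` is a player of the global type `T` (least solution of
the defining equations). -/
inductive IsPlayer (r : Part) : GType → Prop
  | out_head {T : GType} {I hI hp G} (hT : T = GType.out r I hI hp G) : IsPlayer r T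
  | out_tail {T : GType} {p I hI hp G} (hT : T = GType.out p I hI hp G) (i : I)
      (h : IsPlayer r (G i)) : IsPlayer r T
  | inp_head {T : GType} {I hI hp G} (hT : T = GType.inp r I hI hp G) : IsPlayer r T
  | inp_tail {T : GType} {p I hI hp G} (hT : T = GType.inp p I hI hp G) (i : I)
      (h : IsPlayer r (G i)) : IsPlayer r T

/-- The set of players of a global type. -/
def players (T : GType) : Set Part := {r | IsPlayer r T}

/-! ## Paths, depth, boundedness -/

/-- Communications: `out p ℓ q` is the output of `ℓ` from `p` to `q`, and `inp p ℓ q` is the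
input by `p` of `ℓ` sent by `q`. -/
inductive Comm : Type
  | out (p : Part) (l : Lab) (q : Part) : Comm
  | inp (p : Part) (l : Lab) (q : Part) : Comm

/-- The player of a communication. -/
def Comm.play : Comm → Part
  | .out p _ _ => p
  | .inp p _ _ => p

/-- One unfolding of the equations that define the paths of a global type. -/
inductive PathStep (R : GType → Stream'.Seq Comm → Prop) (T : GType) (xi : Stream'.Seq Comm) :
    Prop
  | nil (hT : T = GType.nil) (hxi : xi = Stream'.Seq.nil)
  | out {p I hI hp G} (hT : T = GType.out p I hI hp G) (i : I) (zeta : Stream'.Seq Comm)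
      (hxi : xi = Stream'.Seq.cons (Comm.out p i.1.2 i.1.1) zeta) (h : R (G i) zeta)
  | inp {p I hI hp G} (hT : T = GType.inp p I hI hp G) (i : I) (zeta : Stream'.Seq Comm)
      (hxi : xi = Stream'.Seq.cons (Comm.inp p i.1.2 i.1.1) zeta) (h : R (G i) zeta)

/-- `xi` is a (possibly infinite) path of `T`: greatest solution of the equations. -/
def IsPath (T : GType) (xi : Stream'.Seq Comm) : Prop :=
  ∃ R : GType → Stream'.Seq Comm → Prop, (∀ T xi, R T xi → PathStep R T xi) ∧ R T xi

/-- The position (counted from 1) of the first communication of the path with player `p`;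
infinite if there is none. -/
noncomputable def pathDepth (xi : Stream'.Seq Comm) (p : Part) : ℕ∞ :=
  sInf {n : ℕ∞ | ∃ k : ℕ, n = (k : ℕ∞) + 1 ∧ ∃ b : Comm, xi.get? k = some b ∧ b.play = p}

open Classical in
/-- The depth of a participant in a global type. -/
noncomputable def depth (T : GType) (p : Part) : ℕ∞ :=
  if p ∈ players T then sSup {n : ℕ∞ | ∃ xi, IsPath T xi ∧ n = pathDepth xi p} else 0

/-- Boundedness: every player of `T` has finite depth in every type that occurs in `T`. -/
def Bounded (T : GType) : Prop :=
  ∀ p ∈ players T, ∀ T' : GType, Subterm T' T → depth T' p ≠ ⊤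

/-! ## Inactivity -/

/-- One unfolding of the clauses of the inactivity predicate. -/
inductive InactiveStep (MM : Set Message) (R : GType → Prop) (T : GType) : Prop
  | nil (hT : T = GType.nil)
  | out {p I hI hp G} (hT : T = GType.out p I hI hp G)
      (hM : ∀ i : I, (p, i.1.2, i.1.1) ∉ MM) (h : ∀ i : I, R (G i))
  | inp {p I hI hp G} (hT : T = GType.inp p I hI hp G) (h : ∀ i : I, R (G i))

/-- `T` is inactive for the set `MM` of messages (coinductive predicate): no output that occurs
in `T` produces a message in `MM`. -/
def Inactive (T : GType) (MM : Set Message) : Prop :=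
  ∃ R : GType → Prop, (∀ T, R T → InactiveStep MM R T) ∧ R T

/-! ## The type system -/

/-- The live branches, at the queue `M`, of an input choice of `p` with branches `I`. -/
def live (p : Part) (I : Branches) (M : Queue) : Set (Part × Lab) :=
  {x | x ∈ I ∧ Ready (x.1, x.2, p) M}

/-- The messages that would awaken a dead branch: `(q, ℓ, p)` for a branch `(q, ℓ)` in
`(I ∪ H) \ J` whose sender `q` is not the sender of a live branch. -/
def awakening (p : Part) (I H : Branches) (J : Set (Part × Lab)) : Set Message :=
  {m | ∃ x : Part × Lab, (x ∈ I ∨ x ∈ H) ∧ x ∉ J ∧ (∀ y ∈ J, x.1 ≠ y.1) ∧ m = (x.1, x.2, p)}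

/-- One application of a typing rule with conclusion `T : N ∥ M`, where `R` holds of the
premises. -/
inductive TypingStep (R : GType → Net → Queue → Prop) (T : GType) (N : Net) (M : Queue) : Prop
  | endRule (hT : T = GType.nil) (hN : ∀ p, N p = Proc.nil) (hM : M = [])
  | outRule {p : Part} {I : Branches} {hI hp} {G : I → GType} {P : I → Proc}
      (hT : T = GType.out p I hI hp G)
      (hN : N p = Proc.out I hI P)
      (prem : ∀ i : I, R (G i) (Function.update N p (P i)) (M ++ [(p, i.1.2, i.1.1)]))
      (hplay : ∀ i : I, players (G i) \ {p} = netPlayers N \ {p})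
  | inRule {p : Part} {I H : Branches} {hI hp hH} {G : I → GType} {P : H → Proc}
      (hT : T = GType.inp p I hI hp G)
      (hN : N p = Proc.inp H hH P)
      (J : Set (Part × Lab)) (hJ : J = live p I M) (hJH : J = live p H M) (hne : J.Nonempty)
      (Q : Part × Lab → Queue)
      (hQ : ∀ x ∈ J, QueueEquiv M ((x.1, x.2, p) :: Q x))
      (prem : ∀ (x : Part × Lab) (hx : x ∈ I) (hx2 : x ∈ H), x ∈ J →
        R (G ⟨x, hx⟩) (Function.update N p (P ⟨x, hx2⟩)) (Q x))
      (hinact : ∀ (x : Part × Lab) (hx : x ∈ I), x ∈ J →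
        Inactive (G ⟨x, hx⟩) (awakening p I H J))
      (hplay : ∀ i : I, players (G i) \ {p} = netPlayers N \ {p})

/-- Coinductive derivability of `T : N ∥ M` (derivations may be infinite). -/
def Derivable (T : GType) (N : Net) (M : Queue) : Prop :=
  ∃ R : GType → Net → Queue → Prop,
    (∀ T N M, R T N M → TypingStep R T N M) ∧ R T N M

/-- The typing judgement: `T` is a global type, that is, a regular and bounded term, and it is
derivable for the session `S`. -/
def HasType (T : GType) (S : Session) : Prop :=
  Regular T ∧ Bounded T ∧ Derivable T S.net S.queue

/-- A session is typable if some global type can be derived for it. -/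
def Typable (S : Session) : Prop := ∃ T : GType, HasType T S

/-! ## Finite presentations

Regular terms are given to algorithms as finite sets of equations. The `k`-th entry of the list
is the right-hand side of the equation for the variable `k`; a branch `((q, ℓ), k)` continues
with the variable `k`. -/

/-- Right-hand side of a process equation: `none` is termination, `some (true, bs)` an output
choice and `some (false, bs)` an input choice with the branches `bs`. -/
abbrev ProcRhs := Option (Bool × List ((Part × Lab) × ℕ))

/-- Right-hand side of a global type equation: `none` is `End`, `some (true, p, bs)` an output
choice and `some (false, p, bs)` an input choice of `p` with the branches `bs`. -/
abbrev GRhs := Option (Bool × Part × List ((Part × Lab) × ℕ))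

/-- The list `bs` lists the branches of a choice over `I`, each exactly once, with the
continuations `C` given by the values `X` of variables below `n`. -/
def MatchBranches {A : Type} (n : ℕ) (X : ℕ → A) (bs : List ((Part × Lab) × ℕ))
    (I : Branches) (C : I → A) : Prop :=
  (bs.map Prod.fst).Nodup ∧ (bs.map Prod.fst).toFinset = I ∧
    ∀ b ∈ bs, b.2 < n ∧ ∀ h : b.1 ∈ I, C ⟨b.1, h⟩ = X b.2

/-- The process `P` is the value of the right-hand side under the valuation `X` of the first
`n` variables. -/
def ProcMatches (n : ℕ) (X : ℕ → Proc) : ProcRhs → Proc → Prop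
  | none, P => P = Proc.nil
  | some (true, bs), P => ∃ I hI C, P = Proc.out I hI C ∧ MatchBranches n X bs I C
  | some (false, bs), P => ∃ I hI C, P = Proc.inp I hI C ∧ MatchBranches n X bs I C

/-- The valuation `X` solves the system `E` of process equations. -/
def ProcSolves (E : List ProcRhs) (X : ℕ → Proc) : Prop :=
  ∀ (k : ℕ) (h : k < E.length), ProcMatches E.length X E[k] (X k)

/-- The term `T` is the value of the right-hand side under the valuation `X` of the first `n`
variables. -/
def GMatches (n : ℕ) (X : ℕ → GType) : GRhs → GType → Prop
  | none, T => T = GType.nil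
  | some (true, p, bs), T => ∃ I hI hp C, T = GType.out p I hI hp C ∧ MatchBranches n X bs I C
  | some (false, p, bs), T => ∃ I hI hp C, T = GType.inp p I hI hp C ∧ MatchBranches n X bs I C

/-- The valuation `X` solves the system `E` of global type equations. -/
def GSolves (E : List GRhs) (X : ℕ → GType) : Prop :=
  ∀ (k : ℕ) (h : k < E.length), GMatches E.length X E[k] (X k)

/-- A code of a session: a system of process equations, a list of located variables `(p, k)`
(participant `p` runs the process `k`), and a queue. -/
abbrev SessionCode := List ProcRhs × List (Part × ℕ) × Queue

/-- A code of a global type: a system of equations and the variable of the root. -/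
abbrev GCode := List GRhs × ℕ

/-- The code `c` presents the session `S`. -/
def PresentsSession (c : SessionCode) (S : Session) : Prop :=
  ∃ X : ℕ → Proc, ProcSolves c.1 X ∧
    (c.2.1.map Prod.fst).Nodup ∧
    (∀ e ∈ c.2.1, e.2 < c.1.length ∧ S.net e.1 = X e.2) ∧
    (∀ p, p ∉ c.2.1.map Prod.fst → S.net p = Proc.nil) ∧
    S.queue = c.2.2

/-- The code `c` presents the global type `T`. -/
def PresentsGType (c : GCode) (T : GType) : Prop :=
  ∃ X : ℕ → GType, GSolves c.1 X ∧ c.2 < c.1.length ∧ T = X c.2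

end AsyncSession

open AsyncSession

/-!
Typing is undecidable because a session of two participants can run a queue machine, a finite
automaton that reads from the front of a queue and writes at its back, and halts exactly when it
reads from the empty queue.

*Halting of queue machines.* A queue machine can simulate the stack machine `PartrecToTM2.tr` of
Mathlib, which evaluates partial recursive functions: the queue holds the four stacks one after the
other, top first and each closed by a marker, up to a cyclic rotation (`simulator_respects`). For a
universal function this gives one fixed finite machine whose halting is undecidable as a
function of the input (`exists_undecidable_machine`).

*The session.* Participant `0` is the control of the machine. It reads symbols from participant `1`
and writes symbols to `1`, and `1` is a forwarder that sends back whatever it receives. The queue of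
the machine is the concatenation of the messages from `1` to `0`, the symbol held by `1`, and the
messages from `0` to `1`. After each reading instruction the control also sends a message without
symbol, which the forwarder drops. Its only purpose is that each participant acts in every
round, which boundedness of the global type demands.

*Machines that run forever are typable* (`hasType_of_not_halts`). A fixed global type lets control
and forwarder alternate and offers exactly the branches of the processes. All branches of an input
have the same sender, so the sets of messages in the inactivity condition are empty, and an input
of the control is live as long as the queue of the machine is nonempty.

*Typable sessions belong to machines that run forever* (`not_halts_of_hasType`). A derivation for
any global type can be followed along the reductions of the session. Boundedness makes the control
act infinitely often, and steps of the forwarder do not change the queue of the machine, so the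
actions of the control trace an infinite run.

An algorithm for either problem would thus decide the halting of the machine, even on codes that
vary only in the message queue; for the second problem the code of the global type is fixed.
-/

/-! ### Queue machines -/

namespace QueueMachine

open Turing StateTransition Relation

/-- An instruction of a queue machine with states `St` and alphabet `A`: remove the front symbol
`a` of the queue and continue in state `f a`, or append `a` at the back and continue in `s`. -/
inductive Instr (St A : Type) : Type
  | read (f : A → St) : Instr St A
  | write (a : A) (s : St) : Instr St A

/-- A queue machine assigns an instruction to each of its states. -/
abbrev Machine (St A : Type) := St → Instr St A

variable {St A : Type}

/-- One step of a queue machine on a pair of a state and a queue (front first). The machine halts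
exactly when it has to read from the empty queue. -/
def step (M : Machine St A) (c : St × List A) : Option (St × List A) :=
  match M c.1, c.2 with
  | .read _, [] => none
  | .read f, a :: w => some (f a, w)
  | .write a s, w => some (s, w ++ [a])

/-- The machine halts when started in state `s` with queue `w`. -/
def Halts (M : Machine St A) (s : St) (w : List A) : Prop := (eval (step M) (s, w)).Dom

theorem step_read {M : Machine St A} {s : St} {f : A → St} (h : M s = .read f) (a : A)
    (w : List A) : step M (s, a :: w) = some (f a, w) := by
  simp [step, h]

theorem step_read_nil {M : Machine St A} {s : St} {f : A → St} (h : M s = .read f) :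
    step M (s, []) = none := by
  simp [step, h]

theorem step_write {M : Machine St A} {s s' : St} {a : A} (h : M s = .write a s')
    (w : List A) : step M (s, w) = some (s', w ++ [a]) := by
  simp [step, h]

theorem halts_iff_of_step {M : Machine St A} {s s' : St} {w w' : List A}
    (h : step M (s, w) = some (s', w')) : Halts M s w ↔ Halts M s' w' := by
  unfold Halts
  rw [reaches_eval (ReflTransGen.single (Option.mem_def.2 h))]

theorem halts_of_step_eq_none {M : Machine St A} {s : St} {w : List A}
    (h : step M (s, w) = none) : Halts M s w :=
  Part.dom_iff_mem.2 ⟨_, mem_eval.2 ⟨ReflTransGen.refl, h⟩⟩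

/-- The instruction with its continuations renamed. -/
def Instr.map {St' : Type} (r : St → St') : Instr St A → Instr St' A
  | .read f => .read fun a => r (f a)
  | .write a s => .write a (r s)

/-- All states in which the instruction can continue lie in `F`. -/
def Instr.Into (F : Set St) : Instr St A → Prop
  | .read f => ∀ a, f a ∈ F
  | .write _ s => s ∈ F

/-- A queue machine whose instructions stay within a finite set of states can be replaced by one
with a finite type of states. -/
theorem exists_finite_machine (M : Machine St A) {F : Set St} (hF : F.Finite)
    (hM : ∀ s ∈ F, (M s).Into F) {s₀ : St} (hs₀ : s₀ ∈ F) :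
    ∃ (St' : Type) (_ : Finite St') (M' : Machine St' A) (s₀' : St'),
      ∀ w, Halts M' s₀' w ↔ Halts M s₀ w := by
  classical
  let r : St → F := fun s => if h : s ∈ F then ⟨s, h⟩ else ⟨s₀, hs₀⟩
  have hr : ∀ s ∈ F, (r s : St) = s := fun s hs => by simp [r, hs]
  refine ⟨F, hF, fun s => (M s).map r, ⟨s₀, hs₀⟩, fun w => ?_⟩
  have key : Respects (step fun s : F => (M s).map r) (step M)
      (fun c d => d = ((c.1 : St), c.2)) := by
    rintro ⟨s, w⟩ _ rfl
    have hs := hM s s.2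
    rcases hi : M s with f | ⟨a, s'⟩
    · rw [hi] at hs
      have h' : (fun s : F => (M s).map r) s = .read fun a => r (f a) := by simp [hi, Instr.map]
      cases w with
      | nil => rw [step_read_nil h']; exact step_read_nil hi
      | cons a w =>
        rw [step_read h']
        exact ⟨_, rfl, TransGen.single (by rw [step_read hi, hr _ (hs a)]; rfl)⟩
    · rw [hi] at hs
      have h' : (fun s : F => (M s).map r) s = .write a (r s') := by simp [hi, Instr.map]
      rw [step_write h']
      exact ⟨_, rfl, TransGen.single (by rw [step_write hi, hr _ hs]; rfl)⟩
  exact (tr_eval_dom key rfl).symm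

/-! ### Simulating four stacks with one queue -/

open Turing.PartrecToTM2 Turing.TM2

/-- The cyclic successor of a stack name. -/
def next : K' → K'
  | .main => .rev
  | .rev => .aux
  | .aux => .stack
  | .stack => .main

/-- A stack written top first and closed by the end marker `none`. -/
def segment (L : List Γ') : List (Option Γ') := L.map some ++ [none]

/-- The contents of a queue that stores the four stacks `S` in cyclic order, beginning with the
stack `i`. -/
def layout (S : K' → List Γ') (i : K') : List (Option Γ') :=
  segment (S i) ++ (segment (S (next i)) ++ (segment (S (next (next i))) ++
    segment (S (next (next (next i))))))

/-- The contents of a queue from `layout S i` after its first segment. -/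
def layoutTail (S : K' → List Γ') (i : K') : List (Option Γ') :=
  segment (S (next i)) ++ (segment (S (next (next i))) ++ segment (S (next (next (next i)))))

theorem layout_eq (S : K' → List Γ') (i : K') :
    layout S i = (S i).map some ++ none :: layoutTail S i := by
  simp [layout, layoutTail, segment]

theorem layout_next (S : K' → List Γ') (i : K') :
    layout S (next i) = layoutTail S i ++ segment (S i) := by
  cases i <;> simp [layout, layoutTail, segment, next]

theorem layoutTail_update (S : K' → List Γ') (i : K') (L : List Γ') :
    layoutTail (Function.update S i L) i = layoutTail S i := by
  cases i <;> simp [layoutTail, next, Function.update]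

/-- What the simulating machine is about to do. `(false, i, q, v)`: the queue begins with the stack
`i`, and the statement `q` has to be executed with the value `v` of the local store.
`(true, i, q, v)`: the queue begins with an unread part of the stack `i`, which has to be moved to
the back before the same is done. -/
abbrev Task := Bool × K' × Stmt' × Option Γ'

/-- The states of the simulating machine: an optional symbol that has to be written at once, and
then a task, or `none` for emptying the queue. -/
abbrev SimState := Option (Option Γ') × Option Task

/-- Execute `q` with store `v`, the stack `i` being at the front. -/
abbrev execute (i : K') (q : Stmt') (v : Option Γ') : SimState := (none, some (false, i, q, v))

/-- Move the rest of the segment of stack `i` to the back, then execute `q` with store `v`. -/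
abbrev rotate (i : K') (q : Stmt') (v : Option Γ') : SimState := (none, some (true, i, q, v))

/-- Remove one symbol and write it back; an end marker completes the rotation. -/
def rotateInstr (i : K') (q : Stmt') (v : Option Γ') : Instr SimState (Option Γ') :=
  .read fun
    | none => (some none, some (false, next i, q, v))
    | some x => (some (some x), some (true, i, q, v))

/-- The instruction for executing a statement. A stack operation rotates the queue until its stack
is at the front. Statements that leave the stacks alone rotate the queue once, since a queue machine
has no instruction without effect on the queue. -/
def executeInstr (i : K') (q : Stmt') (v : Option Γ') : Instr SimState (Option Γ') :=
  match q with
  | .push k f q' => if k = i then .write (some (f v)) (rotate i q' v) else rotateInstr i q v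
  | .peek k f q' =>
    if k = i then .read fun
      | none => (some none, some (false, next i, q', f v none))
      | some x => (some (some x), some (true, i, q', f v (some x)))
    else rotateInstr i q v
  | .pop k f q' =>
    if k = i then .read fun
      | none => (some none, some (false, next i, q', f v none))
      | some x => execute i q' (f v (some x))
    else rotateInstr i q v
  | .load f q' => rotateInstr i q' (f v)
  | .branch p q₁ q₂ => rotateInstr i (cond (p v) q₁ q₂) v
  | .goto l => rotateInstr i (tr (l v)) v
  | .halt => .read fun _ => (none, none)

/-- The queue machine that simulates the stack machine `PartrecToTM2.tr`. -/
def simulator : Machine SimState (Option Γ')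
  | (some a, t) => .write a (none, t)
  | (none, none) => .read fun _ => (none, none)
  | (none, some (true, i, q, v)) => rotateInstr i q v
  | (none, some (false, i, q, v)) => executeInstr i q v

/-- A configuration of the stack machine is represented by any rotation of its stacks; halted
configurations are represented by the emptied queue. -/
def Represents (c : TM2.Cfg (fun _ : K' => Γ') Λ' (Option Γ'))
    (d : SimState × List (Option Γ')) : Prop :=
  match c.l with
  | none => d = ((none, none), [])
  | some l => ∃ i, d = (execute i (tr l) c.var, layout c.stk i)

theorem reaches_write (a : Option Γ') (t : Option Task) (w : List (Option Γ')) :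
    Reaches₁ (step simulator) ((some a, t), w) ((none, t), w ++ [a]) :=
  TransGen.single (step_write rfl w)

theorem reaches_drain (w : List (Option Γ')) :
    Reaches (step simulator) ((none, none), w) ((none, none), []) := by
  induction w with
  | nil => exact ReflTransGen.refl
  | cons a w ih => exact ReflTransGen.head (step_read (f := fun _ => (none, none)) rfl a w) ih

theorem reaches_rotateInstr {s : SimState} {i : K'} {q : Stmt'} {v : Option Γ'}
    (hs : simulator s = rotateInstr i q v) (L : List Γ') (w : List (Option Γ')) :
    Reaches₁ (step simulator) (s, L.map some ++ none :: w)
      (execute (next i) q v, w ++ segment L) := by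
  induction L generalizing s w with
  | nil => exact TransGen.head (step_read hs none w) (reaches_write _ _ _)
  | cons x L ih =>
    refine TransGen.head (step_read hs (some x) _) ((reaches_write _ _ _).trans ?_)
    have := ih (s := rotate i q v) rfl (w ++ [some x])
    simpa [segment, Reaches₁] using this

theorem reaches_next {s : SimState} {i : K'} {q : Stmt'} {v : Option Γ'}
    (hs : simulator s = rotateInstr i q v) (S : K' → List Γ') :
    Reaches₁ (step simulator) (s, layout S i) (execute (next i) q v, layout S (next i)) := by
  rw [layout_eq, layout_next]
  exact reaches_rotateInstr hs _ _

/-- If executing `q` amounts to rotating as long as the front stack is not `k`, then the machine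
brings `k` to the front. -/
theorem reaches_front (k : K') (q : Stmt') (v : Option Γ')
    (h : ∀ i, k ≠ i → executeInstr i q v = rotateInstr i q v) (S : K' → List Γ') (i : K') :
    Reaches (step simulator) (execute i q v, layout S i) (execute k q v, layout S k) := by
  -- By induction on the number of rotations after which `k` is at the front.
  have key : ∀ n i, next^[n] i = k →
      Reaches (step simulator) (execute i q v, layout S i) (execute k q v, layout S k) := by
    intro n
    induction n with
    | zero => rintro i rfl; exact ReflTransGen.refl
    | succ n ih =>
      intro i hi
      by_cases hk : k = i
      · subst hk; exact ReflTransGen.refl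
      · exact (reaches_next (s := execute i q v) (h i hk) S).to_reflTransGen.trans (ih _ hi)
  have : ∃ n, next^[n] i = k := by
    cases i <;> cases k <;>
      first | exact ⟨0, rfl⟩ | exact ⟨1, rfl⟩ | exact ⟨2, rfl⟩ | exact ⟨3, rfl⟩
  exact key _ _ this.choose_spec

/-- The simulator carries out a whole statement of the stack machine. -/
theorem reaches_stepAux (q : Stmt') (v : Option Γ') (S : K' → List Γ') (i : K') :
    ∃ d, Represents (stepAux q v S) d ∧
      Reaches₁ (step simulator) (execute i q v, layout S i) d := by
  induction q generalizing v S i with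
  | push k f q ih =>
    -- The pushed symbol is written at the back, and the rotation moves the old stack behind it.
    have front := reaches_front k (.push k f q) v (fun i hi => by simp [executeInstr, hi]) S i
    obtain ⟨d, hd, hr⟩ := ih v (Function.update S k (f v :: S k)) (next k)
    refine ⟨d, hd, TransGen.trans_right front (TransGen.head (step_write
      (s' := rotate k q v) (a := some (f v)) (by simp [simulator, executeInstr]) _) ?_)⟩
    refine TransGen.trans ?_ hr
    rw [layout_eq, layout_next, layoutTail_update]
    have := reaches_rotateInstr (s := rotate k q v) rfl (S k) (layoutTail S k ++ [some (f v)])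
    simpa [segment, Reaches₁] using this
  | peek k f q ih =>
    have front := reaches_front k (.peek k f q) v (fun i hi => by simp [executeInstr, hi]) S i
    obtain ⟨d, hd, hr⟩ := ih (f v (S k).head?) S (next k)
    refine ⟨d, hd, TransGen.trans_right front (TransGen.trans ?_ hr)⟩
    have hM : simulator (execute k (.peek k f q) v) = .read fun
      | none => (some none, some (false, next k, q, f v none))
      | some x => (some (some x), some (true, k, q, f v (some x))) := by
        simp [simulator, executeInstr]
    rw [layout_eq, layout_next]
    cases hS : S k with
    | nil => exact TransGen.head (step_read hM none _) (reaches_write _ _ _)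
    | cons x L =>
      refine TransGen.head (step_read hM (some x) _) ((reaches_write _ _ _).trans ?_)
      have := reaches_rotateInstr (s := rotate k q (f v (some x))) rfl L
        (layoutTail S k ++ [some x])
      simpa [segment, Reaches₁] using this
  | pop k f q ih =>
    have front := reaches_front k (.pop k f q) v (fun i hi => by simp [executeInstr, hi]) S i
    have hM : simulator (execute k (.pop k f q) v) = .read fun
      | none => (some none, some (false, next k, q, f v none))
      | some x => execute k q (f v (some x)) := by
        simp [simulator, executeInstr]
    cases hS : S k with
    | nil =>
      obtain ⟨d, hd, hr⟩ := ih (f v none) S (next k)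
      have hu : Function.update S k [] = S := by rw [← hS, Function.update_eq_self]
      refine ⟨d, by simpa [hS, hu] using hd, TransGen.trans_right front (TransGen.trans ?_ hr)⟩
      rw [layout_eq, layout_next, hS]
      exact TransGen.head (step_read hM none _) (reaches_write _ _ _)
    | cons x L =>
      obtain ⟨d, hd, hr⟩ := ih (f v (some x)) (Function.update S k L) k
      refine ⟨d, by simpa [hS] using hd, TransGen.trans_right front (TransGen.head ?_ hr)⟩
      rw [layout_eq, layout_eq, layoutTail_update, hS, Function.update_self]
      exact step_read hM (some x) _
  | load f q ih =>
    obtain ⟨d, hd, hr⟩ := ih (f v) S (next i)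
    exact ⟨d, hd, (reaches_next rfl S).trans hr⟩
  | branch p q₁ q₂ ih₁ ih₂ =>
    cases hp : p v with
    | true =>
      obtain ⟨d, hd, hr⟩ := ih₁ v S (next i)
      exact ⟨d, by simpa [hp] using hd,
        (reaches_next (by simp only [simulator, executeInstr, hp]; rfl) S).trans hr⟩
    | false =>
      obtain ⟨d, hd, hr⟩ := ih₂ v S (next i)
      exact ⟨d, by simpa [hp] using hd,
        (reaches_next (by simp only [simulator, executeInstr, hp]; rfl) S).trans hr⟩
  | goto l =>
    exact ⟨_, ⟨next i, rfl⟩, reaches_next rfl S⟩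
  | halt =>
    refine ⟨_, rfl, ?_⟩
    have hM : simulator (execute i .halt v) = .read fun _ => (none, none) := rfl
    rw [layout_eq]
    cases S i with
    | nil => exact TransGen.head' (step_read hM _ _) (reaches_drain _)
    | cons x L => exact TransGen.head' (step_read hM _ _) (reaches_drain _)

theorem simulator_respects : Respects (TM2.step tr) (step simulator) Represents := by
  rintro ⟨l, v, S⟩ d hd
  cases l with
  | none => cases hd; rfl
  | some l =>
    obtain ⟨i, rfl⟩ := hd
    exact reaches_stepAux (tr l) v S i

/-- The states of the simulator whose task, if there is one, concerns a statement from `Q`. -/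
def simStates (Q : Set Stmt') : Set SimState :=
  {s | ∀ t ∈ s.2, t.2.2.1 ∈ Q}

theorem finite_simStates {Q : Set Stmt'} (hQ : Q.Finite) : (simStates Q).Finite := by
  have hK : Finite K' := by
    refine Finite.of_injective (β := Fin 4)
      (fun | .main => 0 | .rev => 1 | .aux => 2 | .stack => 3) ?_
    intro a b; cases a <;> cases b <;> simp
  have : Finite Q := hQ
  let g : Option (Option Γ') × Option (Bool × K' × Q × Option Γ') → SimState :=
    fun s => (s.1, s.2.map fun t => (t.1, t.2.1, t.2.2.1.1, t.2.2.2))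
  refine (Set.finite_range g).subset ?_
  rintro ⟨a, _ | ⟨b, i, q, v⟩⟩ hs
  · exact ⟨(a, none), rfl⟩
  · exact ⟨(a, some (b, i, ⟨q, hs _ rfl⟩, v)), rfl⟩

theorem simulator_into {Q : Set Stmt'}
    (hQ : ∀ q ∈ Q, ∀ v : Option Γ', match q with
      | .push _ _ q' => q' ∈ Q
      | .peek _ _ q' => q' ∈ Q
      | .pop _ _ q' => q' ∈ Q
      | .load _ q' => q' ∈ Q
      | .branch _ q₁ q₂ => q₁ ∈ Q ∧ q₂ ∈ Q
      | .goto l => tr (l v) ∈ Q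
      | .halt => True) :
    ∀ s ∈ simStates Q, (simulator s).Into (simStates Q) := by
  have hrot : ∀ i q v, q ∈ Q → (rotateInstr i q v).Into (simStates Q) := by
    rintro i q v hq (_ | x) t ⟨⟩ <;> exact hq
  rintro ⟨_ | a, _ | ⟨_ | _, i, q, v⟩⟩ hs
  · rintro a t ⟨⟩
  · have hq : q ∈ Q := hs _ rfl
    have hQ' := hQ q hq v
    change (executeInstr i q v).Into _
    cases q with
    | push k f q' =>
      simp only [executeInstr]
      split_ifs
      · rintro t ⟨⟩; exact hQ'
      · exact hrot _ _ _ hq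
    | peek k f q' =>
      simp only [executeInstr]
      split_ifs
      · rintro (_ | x) t ⟨⟩ <;> exact hQ'
      · exact hrot _ _ _ hq
    | pop k f q' =>
      simp only [executeInstr]
      split_ifs
      · rintro (_ | x) t ⟨⟩ <;> exact hQ'
      · exact hrot _ _ _ hq
    | load f q' => exact hrot _ _ _ hQ'
    | branch p q₁ q₂ =>
      refine hrot _ _ _ ?_
      cases p v
      exacts [hQ'.2, hQ'.1]
    | goto l => exact hrot _ _ _ hQ'
    | halt => rintro a t ⟨⟩
  · exact hrot _ _ _ (hs _ rfl)
  all_goals exact hs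

/-- The statements in the program for a code. -/
def codeStmts (c : ToPartrec.Code) : Set Stmt' :=
  {q | ∃ l ∈ codeSupp c .halt, q ∈ stmts₁ (tr l)}

/-- A finite queue machine evaluates a given code. The input `n` is on the first stack, and the
other three stacks are empty. -/
theorem exists_simulator (c : ToPartrec.Code) :
    ∃ (St : Type) (_ : Finite St) (M : Machine St (Option Γ')) (s₀ : St),
      ∀ n : ℕ, Halts M s₀ (segment (trList [n]) ++ [none, none, none]) ↔
        (ToPartrec.Code.eval c [n]).Dom := by
  have hsupp := tr_supports c .halt
  have hfin : (codeStmts c).Finite := by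
    refine ((codeSupp c .halt).finite_toSet.biUnion
      fun l _ => (stmts₁ (tr l)).finite_toSet).subset ?_
    rintro q ⟨l, hl, hq⟩
    simp only [Set.mem_iUnion]
    exact ⟨l, hl, hq⟩
  have hinto := simulator_into (Q := codeStmts c) (by
    rintro q ⟨l, hl, hq⟩ v
    have hs := stmts₁_supportsStmt_mono hq (hsupp.2 l hl)
    cases q with
    | goto l' => exact ⟨_, hs v, stmts₁_self⟩
    | halt => trivial
    | branch p q₁ q₂ =>
      exact ⟨⟨l, hl, stmts₁_trans hq (by simp [stmts₁, stmts₁_self])⟩,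
        ⟨l, hl, stmts₁_trans hq (by simp [stmts₁, stmts₁_self])⟩⟩
    | _ => exact ⟨l, hl, stmts₁_trans hq (by simp [stmts₁, stmts₁_self])⟩)
  have hstart : execute .main (tr (trNormal c .halt)) none ∈ simStates (codeStmts c) := by
    rintro t ⟨⟩
    exact ⟨_, hsupp.1, stmts₁_self⟩
  obtain ⟨St, hSt, M, s₀, hM⟩ :=
    exists_finite_machine simulator (finite_simStates hfin) hinto hstart
  refine ⟨St, hSt, M, s₀, fun n => (hM _).trans ?_⟩
  refine (tr_eval_dom simulator_respects (a₁ := PartrecToTM2.init c [n]) ⟨.main, ?_⟩).trans ?_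
  · rfl
  · rw [PartrecToTM2.tr_eval]; rfl

end QueueMachine

/-! ### Undecidability of halting for queue machines -/

namespace QueueMachine

open Turing StateTransition Turing.PartrecToTM2

theorem trNat_two_mul (n : ℕ) (hn : n ≠ 0) : trNat (2 * n) = Γ'.bit0 :: trNat n := by
  have h : ((2 * n : ℕ) : Num) = Num.bit0 (n : Num) := by
    apply Num.to_nat_inj.1
    rw [Num.cast_bit0, Num.to_of_nat, Num.to_of_nat]
  unfold trNat
  rw [h]
  rcases hm : (n : Num) with _ | m
  · exact absurd (by simpa using congrArg (fun k : Num => (k : ℕ)) hm) hn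
  · rfl

theorem trNat_two_mul_add_one (n : ℕ) : trNat (2 * n + 1) = Γ'.bit1 :: trNat n := by
  have h : ((2 * n + 1 : ℕ) : Num) = Num.bit1 (n : Num) := by
    apply Num.to_nat_inj.1
    rw [Num.cast_bit1, Num.to_of_nat, Num.to_of_nat]
  unfold trNat
  rw [h]
  rcases (n : Num) with _ | m <;> rfl

theorem primrec_map_trNat {α : Type} [Primcodable α] (g : Γ' → α) :
    Primrec fun n => (trNat n).map g := by
  let G : Unit → List (List α) → Option (List α) := fun _ l =>
    if l.length = 0 then some [] else
      l[l.length / 2]?.map fun t => (if l.length % 2 = 1 then g .bit1 else g .bit0) :: t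
  have hlen : Primrec fun p : Unit × List (List α) => p.2.length :=
    Primrec.list_length.comp Primrec.snd
  have hG : Primrec₂ G := by
    refine Primrec.ite (PrimrecRel.comp Primrec.eq hlen (Primrec.const 0)) (Primrec.const _) ?_
    refine Primrec.option_map
      (Primrec.list_getElem?.comp Primrec.snd (Primrec.nat_div.comp hlen (Primrec.const 2))) ?_
    refine Primrec.list_cons.comp (Primrec.ite ?_ (Primrec.const _) (Primrec.const _)) Primrec.snd
    exact PrimrecRel.comp Primrec.eq
      (Primrec.nat_mod.comp (hlen.comp Primrec.fst) (Primrec.const 2)) (Primrec.const 1)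
  have := Primrec.nat_strong_rec (fun (_ : Unit) n => (trNat n).map g) hG (by
    intro _ n
    simp only [G, List.length_map, List.length_range]
    rcases Nat.eq_zero_or_pos n with rfl | hn
    · simp
    · rw [if_neg hn.ne', List.getElem?_map, List.getElem?_range (by omega)]
      rcases Nat.even_or_odd' n with ⟨k, rfl | rfl⟩
      · rw [trNat_two_mul k (by omega)]
        simp
      · rw [trNat_two_mul_add_one, show (2 * k + 1) / 2 = k by omega,
          show (2 * k + 1) % 2 = 1 by omega]
        simp)
  exact this.comp (Primrec.const ()) Primrec.id

/-- There is a queue machine whose halting is undecidable for inputs that are computable from a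
natural number: the simulator of a universal partial recursive function. -/
theorem exists_undecidable_machine :
    ∃ (St : Type) (_ : Finite St) (M : Machine St (Option Γ')) (s₀ : St)
      (input : ℕ → List (Option Γ')),
      (∀ g : Option Γ' → ℕ × ℕ × ℕ, Computable fun n => (input n).map g) ∧
        ¬ ∃ f : ℕ → Bool, Computable f ∧ ∀ n, f n = true ↔ ¬ Halts M s₀ (input n) := by
  have huniv : Partrec fun n : ℕ => (Denumerable.ofNat Nat.Partrec.Code n).eval 0 :=
    Nat.Partrec.Code.eval_part.comp
      (Computable.ofNat Nat.Partrec.Code) (Computable.const 0)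
  obtain ⟨c, hc⟩ := ToPartrec.Code.exists_code (Nat.Partrec'.part_iff₁.2 huniv)
  obtain ⟨St, hSt, M, s₀, hM⟩ := exists_simulator c
  refine ⟨St, hSt, M, s₀, fun n => segment (trList [n]) ++ [none, none, none], fun g => ?_, ?_⟩
  · have h := (primrec_map_trNat fun x => g (some x)).to_comp
    refine (Computable.list_append.comp h (Computable.const
      [g (some Γ'.cons), g none, g none, g none, g none])).of_eq fun n => ?_
    simp [segment]
  · rintro ⟨f, hf, hfM⟩
    refine ComputablePred.halting_problem 0 (ComputablePred.computable_iff.2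
      ⟨fun d : Nat.Partrec.Code => !f (Encodable.encode d),
        Primrec.not.to_comp.comp (hf.comp Computable.encode), ?_⟩)
    funext d
    have hd := hM (Encodable.encode d)
    have hcd := hc ⟨[Encodable.encode d], rfl⟩
    simp only [List.Vector.head, Denumerable.ofNat_encode] at hcd
    rw [hcd] at hd
    have hd' : Halts M s₀ (segment (trList [Encodable.encode d]) ++ [none, none, none]) ↔
        (d.eval 0).Dom := by
      simpa using hd
    have hf' := hfM (Encodable.encode d)
    rw [hd'] at hf'
    simp only [Bool.not_eq_true', eq_iff_iff]
    rw [← Bool.not_eq_true, hf', not_not]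

end QueueMachine

namespace AsyncSession

open PFunctor (M)

/-! ### Terms given by finite coalgebras -/

theorem isChild_corec {F : PFunctor.{0, 0}} {V : Type} {g : V → F V} {v : V} {s : F.M} :
    IsChild s (M.corec g v) ↔ ∃ b, s = M.corec g ((g v).2 b) := by
  unfold IsChild
  rw [M.dest_corec]
  exact exists_congr fun b => eq_comm

theorem exists_of_subterm_corec {F : PFunctor.{0, 0}} {V : Type} {g : V → F V} {v : V} {s : F.M}
    (h : Subterm s (M.corec g v)) : ∃ u, s = M.corec g u := by
  induction h using Relation.ReflTransGen.head_induction_on with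
  | refl => exact ⟨v, rfl⟩
  | head hst _ ih =>
    obtain ⟨u, rfl⟩ := ih
    obtain ⟨b, rfl⟩ := isChild_corec.1 hst
    exact ⟨_, rfl⟩

theorem regular_corec {F : PFunctor.{0, 0}} {V : Type} [Finite V] (g : V → F V) (v : V) :
    Regular (M.corec g v) :=
  (Set.finite_range (M.corec g)).subset fun _ h =>
    let ⟨u, hu⟩ := exists_of_subterm_corec h
    ⟨u, hu.symm⟩

theorem corec_eq_procOut {V : Type} {g : V → procF V} {v : V} {I : Branches} {hI : I.Nonempty}
    {C : I → V} (h : g v = ⟨.out I hI, C⟩) :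
    M.corec g v = Proc.out I hI fun i => M.corec g (C i) := by
  rw [M.corec_def, h]; rfl

theorem corec_eq_procInp {V : Type} {g : V → procF V} {v : V} {I : Branches} {hI : I.Nonempty}
    {C : I → V} (h : g v = ⟨.inp I hI, C⟩) :
    M.corec g v = Proc.inp I hI fun i => M.corec g (C i) := by
  rw [M.corec_def, h]; rfl

theorem corec_eq_procNil {V : Type} {g : V → procF V} {v : V} {C : Empty → V}
    (h : g v = ⟨.nil, C⟩) : M.corec g v = Proc.nil := by
  rw [M.corec_def, h]
  exact congrArg M.mk (Sigma.ext rfl (heq_of_eq (funext fun b => b.elim)))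

theorem corec_eq_globalOut {V : Type} {g : V → globalF V} {v : V} {p : Part} {I : Branches}
    {hI : I.Nonempty} {hp : ∀ x ∈ I, p ≠ x.1} {C : I → V} (h : g v = ⟨.out p I hI hp, C⟩) :
    M.corec g v = GType.out p I hI hp fun i => M.corec g (C i) := by
  rw [M.corec_def, h]; rfl

theorem corec_eq_globalInp {V : Type} {g : V → globalF V} {v : V} {p : Part} {I : Branches}
    {hI : I.Nonempty} {hp : ∀ x ∈ I, p ≠ x.1} {C : I → V} (h : g v = ⟨.inp p I hI hp, C⟩) :
    M.corec g v = GType.inp p I hI hp fun i => M.corec g (C i) := by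
  rw [M.corec_def, h]; rfl

theorem corec_eq_globalNil {V : Type} {g : V → globalF V} {v : V} {C : Empty → V}
    (h : g v = ⟨.nil, C⟩) : M.corec g v = GType.nil := by
  rw [M.corec_def, h]
  exact congrArg M.mk (Sigma.ext rfl (heq_of_eq (funext fun b => b.elim)))

/-- A list of the branches in `I` together with their continuations. -/
noncomputable def branchList (I : Branches) (C : I → ℕ) : List ((Part × Lab) × ℕ) :=
  I.attach.toList.map fun i => (i.1, C i)

theorem matchBranches_branchList {A : Type} {n : ℕ} {X : ℕ → A} {I : Branches} {K : I → ℕ}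
    {C : I → A} (hK : ∀ i, K i < n) (hX : ∀ i, C i = X (K i)) :
    MatchBranches n X (branchList I K) I C := by
  have hfst : (branchList I K).map Prod.fst = I.attach.toList.map Subtype.val := by
    simp [branchList, Function.comp_def]
  refine ⟨?_, ?_, ?_⟩
  · rw [hfst]
    exact (Finset.nodup_toList _).map Subtype.val_injective
  · rw [hfst]
    ext x
    simp
  · intro b hb
    simp only [branchList, List.mem_map, Finset.mem_toList] at hb
    obtain ⟨i, _, rfl⟩ := hb
    exact ⟨hK i, fun _ => hX i⟩

/-- Every finite coalgebra of the signature of processes amounts to a finite system of equations. -/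
theorem exists_procSolves {V : Type} [Finite V] (g : V → procF V) :
    ∃ (E : List ProcRhs) (index : V → ℕ) (X : ℕ → Proc), ProcSolves E X ∧
      ∀ v, index v < E.length ∧ X (index v) = M.corec g v := by
  classical
  obtain ⟨n, ⟨e⟩⟩ := Finite.exists_equiv_fin V
  let rhs : V → ProcRhs := fun v => match g v with
    | ⟨.nil, _⟩ => none
    | ⟨.out I _, C⟩ => some (true, branchList I fun i => e (C i))
    | ⟨.inp I _, C⟩ => some (false, branchList I fun i => e (C i))
  let X : ℕ → Proc := fun k => if h : k < n then M.corec g (e.symm ⟨k, h⟩) else Proc.nil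
  have hX : ∀ v, X (e v) = M.corec g v := fun v => by simp [X]
  refine ⟨List.ofFn fun k => rhs (e.symm k), fun v => e v, X, ?_, fun v => ⟨by simp, hX v⟩⟩
  intro k hk
  have hk' : k < n := by simpa using hk
  obtain ⟨v, hv⟩ : ∃ v, v = e.symm ⟨k, hk'⟩ := ⟨_, rfl⟩
  have hXk : X k = M.corec g v := by simp [X, hk', hv]
  rw [List.getElem_ofFn, List.length_ofFn, hXk, ← hv]
  rcases hg : g v with ⟨_ | ⟨I, hI⟩ | ⟨I, hI⟩, C⟩
  · simp only [rhs, hg]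
    exact corec_eq_procNil hg
  · simp only [rhs, hg]
    exact ⟨I, hI, _, corec_eq_procOut hg, matchBranches_branchList (fun i => (e _).2)
      fun i => (hX _).symm⟩
  · simp only [rhs, hg]
    exact ⟨I, hI, _, corec_eq_procInp hg, matchBranches_branchList (fun i => (e _).2)
      fun i => (hX _).symm⟩

/-- Every finite coalgebra of the signature of global types amounts to a finite system of
equations. -/
theorem exists_gSolves {V : Type} [Finite V] (g : V → globalF V) :
    ∃ (E : List GRhs) (index : V → ℕ) (X : ℕ → GType), GSolves E X ∧
      ∀ v, index v < E.length ∧ X (index v) = M.corec g v := by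
  classical
  obtain ⟨n, ⟨e⟩⟩ := Finite.exists_equiv_fin V
  let rhs : V → GRhs := fun v => match g v with
    | ⟨.nil, _⟩ => none
    | ⟨.out p I _ _, C⟩ => some (true, p, branchList I fun i => e (C i))
    | ⟨.inp p I _ _, C⟩ => some (false, p, branchList I fun i => e (C i))
  let X : ℕ → GType := fun k => if h : k < n then M.corec g (e.symm ⟨k, h⟩) else GType.nil
  have hX : ∀ v, X (e v) = M.corec g v := fun v => by simp [X]
  refine ⟨List.ofFn fun k => rhs (e.symm k), fun v => e v, X, ?_, fun v => ⟨by simp, hX v⟩⟩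
  intro k hk
  have hk' : k < n := by simpa using hk
  obtain ⟨v, hv⟩ : ∃ v, v = e.symm ⟨k, hk'⟩ := ⟨_, rfl⟩
  have hXk : X k = M.corec g v := by simp [X, hk', hv]
  rw [List.getElem_ofFn, List.length_ofFn, hXk, ← hv]
  rcases hg : g v with ⟨_ | ⟨p, I, hI, hp⟩ | ⟨p, I, hI, hp⟩, C⟩
  · simp only [rhs, hg]
    exact corec_eq_globalNil hg
  · simp only [rhs, hg]
    exact ⟨I, hI, hp, _, corec_eq_globalOut hg, matchBranches_branchList (fun i => (e _).2)
      fun i => (hX _).symm⟩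
  · simp only [rhs, hg]
    exact ⟨I, hI, hp, _, corec_eq_globalInp hg, matchBranches_branchList (fun i => (e _).2)
      fun i => (hX _).symm⟩

theorem Proc.out_inj {I I' : Branches} {hI hI'} {P : I → Proc} {P' : I' → Proc}
    (h : Proc.out I hI P = Proc.out I' hI' P') :
    I = I' ∧ ∀ x (hx : x ∈ I) (hx' : x ∈ I'), P ⟨x, hx⟩ = P' ⟨x, hx'⟩ := by
  have h' := M.mk_inj h
  cases h'
  exact ⟨rfl, fun _ _ _ => rfl⟩

theorem Proc.inp_inj {I I' : Branches} {hI hI'} {P : I → Proc} {P' : I' → Proc}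
    (h : Proc.inp I hI P = Proc.inp I' hI' P') :
    I = I' ∧ ∀ x (hx : x ∈ I) (hx' : x ∈ I'), P ⟨x, hx⟩ = P' ⟨x, hx'⟩ := by
  have h' := M.mk_inj h
  cases h'
  exact ⟨rfl, fun _ _ _ => rfl⟩

theorem Proc.out_ne_inp {I I' : Branches} {hI hI'} {P : I → Proc} {P' : I' → Proc} :
    Proc.out I hI P ≠ Proc.inp I' hI' P' := fun h => by
  have h' := congrArg Sigma.fst (M.mk_inj h)
  cases h'

theorem Proc.out_ne_nil {I : Branches} {hI} {P : I → Proc} : Proc.out I hI P ≠ Proc.nil :=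
  fun h => by
    have h' := congrArg Sigma.fst (M.mk_inj h)
    cases h'

theorem Proc.inp_ne_nil {I : Branches} {hI} {P : I → Proc} : Proc.inp I hI P ≠ Proc.nil :=
  fun h => by
    have h' := congrArg Sigma.fst (M.mk_inj h)
    cases h'

/-! ### Players and paths of global types -/

theorem GType.cases (T : GType) : T = GType.nil ∨
    (∃ p I hI hp G, T = GType.out p I hI hp G) ∨ ∃ p I hI hp G, T = GType.inp p I hI hp G := by
  rcases hT : M.dest T with ⟨_ | ⟨p, I, hI, hp⟩ | ⟨p, I, hI, hp⟩, G⟩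
  · left
    rw [← M.mk_dest T, hT]
    exact congrArg M.mk (Sigma.ext rfl (heq_of_eq (funext fun b => b.elim)))
  · right; left
    exact ⟨p, I, hI, hp, G, by rw [← M.mk_dest T, hT]; rfl⟩
  · right; right
    exact ⟨p, I, hI, hp, G, by rw [← M.mk_dest T, hT]; rfl⟩

/-- The player of the communications at the root of a global type. -/
def headPlayer (T : GType) : Option Part :=
  match (M.dest T).1 with
  | .nil => none
  | .out p _ _ _ => some p
  | .inp p _ _ _ => some p

theorem isChild_out {p : Part} {I : Branches} {hI hp} {G : I → GType} {T : GType} :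
    IsChild T (GType.out p I hI hp G) ↔ ∃ i, G i = T := Iff.rfl

theorem isChild_inp {p : Part} {I : Branches} {hI hp} {G : I → GType} {T : GType} :
    IsChild T (GType.inp p I hI hp G) ↔ ∃ i, G i = T := Iff.rfl

theorem not_isChild_nil {T : GType} : ¬ IsChild T GType.nil := fun ⟨b, _⟩ => b.elim

theorem isPlayer_iff {r : Part} {T : GType} :
    IsPlayer r T ↔ headPlayer T = some r ∨ ∃ T', IsChild T' T ∧ IsPlayer r T' := by
  constructor
  · rintro (⟨rfl⟩ | ⟨rfl, i, h⟩ | ⟨rfl⟩ | ⟨rfl, i, h⟩)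
    · exact .inl rfl
    · exact .inr ⟨_, ⟨i, rfl⟩, h⟩
    · exact .inl rfl
    · exact .inr ⟨_, ⟨i, rfl⟩, h⟩
  · rcases T.cases with rfl | ⟨p, I, hI, hp, G, rfl⟩ | ⟨p, I, hI, hp, G, rfl⟩
    · rintro (h | ⟨T', h, -⟩)
      · cases h
      · exact (not_isChild_nil h).elim
    · rintro (h | ⟨T', ⟨i, rfl⟩, h⟩)
      · cases h; exact .out_head rfl
      · exact .out_tail rfl i h
    · rintro (h | ⟨T', ⟨i, rfl⟩, h⟩)
      · cases h; exact .inp_head rfl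
      · exact .inp_tail rfl i h

theorem isPlayer_of_headPlayer_eq {r : Part} {T : GType} (h : headPlayer T = some r) :
    IsPlayer r T := isPlayer_iff.2 (.inl h)

theorem IsPlayer.of_isChild {r : Part} {T T' : GType} (h : IsPlayer r T') (hT : IsChild T' T) :
    IsPlayer r T := isPlayer_iff.2 (.inr ⟨T', hT, h⟩)

theorem isPath_iff {T : GType} {xi : Stream'.Seq Comm} : IsPath T xi ↔ PathStep IsPath T xi := by
  have mono : ∀ {R R' : GType → Stream'.Seq Comm → Prop}, (∀ T xi, R T xi → R' T xi) →
      ∀ T xi, PathStep R T xi → PathStep R' T xi := by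
    rintro R R' h T xi (⟨h1, h2⟩ | ⟨h1, i, z, h2, h3⟩ | ⟨h1, i, z, h2, h3⟩)
    · exact .nil h1 h2
    · exact .out h1 i z h2 (h _ _ h3)
    · exact .inp h1 i z h2 (h _ _ h3)
  constructor
  · rintro ⟨R, hR, h⟩
    exact mono (fun _ _ h => ⟨R, hR, h⟩) _ _ (hR _ _ h)
  · intro h
    refine ⟨PathStep IsPath, mono ?_, h⟩
    rintro T xi ⟨R, hR, h⟩
    exact mono (fun _ _ h => ⟨R, hR, h⟩) _ _ (hR _ _ h)

theorem IsPath.exists_eq_cons {T : GType} {xi : Stream'.Seq Comm} (h : IsPath T xi) {p : Part}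
    (hT : headPlayer T = some p) : ∃ b zeta T', xi = Stream'.Seq.cons b zeta ∧ b.play = p ∧
      IsChild T' T ∧ IsPath T' zeta := by
  rcases isPath_iff.1 h with ⟨rfl, -⟩ | ⟨rfl, i, z, hxi, hz⟩ | ⟨rfl, i, z, hxi, hz⟩
  · cases hT
  · cases hT; exact ⟨_, z, _, hxi, rfl, ⟨i, rfl⟩, hz⟩
  · cases hT; exact ⟨_, z, _, hxi, rfl, ⟨i, rfl⟩, hz⟩

theorem IsPath.exists_cons {T T' : GType} {zeta : Stream'.Seq Comm} (h : IsPath T' zeta)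
    (hT : IsChild T' T) : ∃ b : Comm, headPlayer T = some b.play ∧
      IsPath T (Stream'.Seq.cons b zeta) := by
  rcases T.cases with rfl | ⟨p, I, hI, hp, G, rfl⟩ | ⟨p, I, hI, hp, G, rfl⟩
  · exact (not_isChild_nil hT).elim
  · obtain ⟨i, rfl⟩ := hT
    exact ⟨_, rfl, isPath_iff.2 (.out rfl i zeta rfl h)⟩
  · obtain ⟨i, rfl⟩ := hT
    exact ⟨_, rfl, isPath_iff.2 (.inp rfl i zeta rfl h)⟩

/-- Paths exist, so a bound on the positions in all paths is never vacuous. -/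
theorem exists_isPath (T : GType) : ∃ xi, IsPath T xi := by
  classical
  -- One step of a path that always takes some branch, as a function for `Stream'.Seq.corec`.
  have hstep : ∀ T : GType, ∃ o : Option (Comm × GType),
      ∀ R : GType → Stream'.Seq Comm → Prop, ∀ xi, (match o with
        | none => xi = Stream'.Seq.nil
        | some (b, T') => ∃ zeta, xi = Stream'.Seq.cons b zeta ∧ R T' zeta) → PathStep R T xi := by
    intro T
    rcases T.cases with rfl | ⟨p, I, hI, hp, G, rfl⟩ | ⟨p, I, hI, hp, G, rfl⟩
    · exact ⟨none, fun R xi h => .nil rfl h⟩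
    · obtain ⟨x, hx⟩ := hI
      exact ⟨some (_, _), fun R xi ⟨z, h, hz⟩ => .out rfl ⟨x, hx⟩ z h hz⟩
    · obtain ⟨x, hx⟩ := hI
      exact ⟨some (_, _), fun R xi ⟨z, h, hz⟩ => .inp rfl ⟨x, hx⟩ z h hz⟩
  choose f hf using hstep
  refine ⟨Stream'.Seq.corec f T, fun T xi => xi = Stream'.Seq.corec f T, ?_, rfl⟩
  rintro T _ rfl
  apply hf
  have := Stream'.Seq.corec_eq f T
  rcases hT : f T with _ | ⟨b, T'⟩
  · rw [hT] at this
    exact Stream'.Seq.destruct_eq_none this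
  · rw [hT] at this
    exact ⟨_, Stream'.Seq.destruct_eq_cons this, rfl⟩

theorem pathDepth_le_iff {xi : Stream'.Seq Comm} {r : Part} {n : ℕ} :
    pathDepth xi r ≤ n ↔ ∃ k < n, ∃ b, xi.get? k = some b ∧ b.play = r := by
  constructor
  · intro h
    have hne : {n : ℕ∞ | ∃ k : ℕ, n = (k : ℕ∞) + 1 ∧
        ∃ b : Comm, xi.get? k = some b ∧ b.play = r}.Nonempty := by
      by_contra hemp
      rw [Set.not_nonempty_iff_eq_empty] at hemp
      rw [pathDepth, hemp, sInf_empty] at h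
      exact absurd h (by simp)
    obtain ⟨k, hk, hb⟩ := csInf_mem hne
    refine ⟨k, ?_, hb⟩
    change pathDepth xi r = _ at hk
    rw [hk] at h
    exact_mod_cast h
  · rintro ⟨k, hk, hb⟩
    have h : pathDepth xi r ≤ (k : ℕ∞) + 1 := sInf_le ⟨k, rfl, hb⟩
    refine h.trans ?_
    exact_mod_cast hk

/-- On every path of the global type, the player `r` acts among the first `n` communications. -/
def ActsWithin (r : Part) : ℕ → GType → Prop
  | 0, _ => False
  | n + 1, T => headPlayer T = some r ∨
      headPlayer T ≠ none ∧ ∀ T', IsChild T' T → ActsWithin r n T'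

theorem actsWithin_iff {r : Part} {n : ℕ} {T : GType} :
    ActsWithin r n T ↔ ∀ xi, IsPath T xi → pathDepth xi r ≤ n := by
  induction n generalizing T with
  | zero =>
    obtain ⟨xi, hxi⟩ := exists_isPath T
    refine ⟨False.elim, fun h => ?_⟩
    obtain ⟨k, hk, -⟩ := pathDepth_le_iff.1 (h xi hxi)
    omega
  | succ n ih =>
    constructor
    · intro h xi hxi
      obtain ⟨p, hp⟩ : ∃ p, headPlayer T = some p := by
        rcases h with h | h
        exacts [⟨r, h⟩, Option.ne_none_iff_exists'.1 h.1]
      obtain ⟨b, z, T', rfl, hb, hT', hz⟩ := hxi.exists_eq_cons hp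
      rcases h with h | h
      · exact pathDepth_le_iff.2 ⟨0, by omega, b, rfl, by rw [hb]; rw [hp] at h; simpa using h⟩
      · obtain ⟨k, hk, c, hc⟩ := pathDepth_le_iff.1 (ih.1 (h.2 T' hT') z hz)
        exact pathDepth_le_iff.2 ⟨k + 1, by omega, c, by simpa using hc⟩
    · intro h
      by_cases hr : headPlayer T = some r
      · exact .inl hr
      refine .inr ⟨fun hn => ?_, fun T' hT' => ih.2 fun z hz => ?_⟩
      · obtain ⟨xi, hxi⟩ := exists_isPath T
        obtain ⟨k, hk, b, hb, -⟩ := pathDepth_le_iff.1 (h xi hxi)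
        rcases isPath_iff.1 hxi with ⟨rfl, rfl⟩ | ⟨rfl, -⟩ | ⟨rfl, -⟩
        · simp at hb
        · cases hn
        · cases hn
      · obtain ⟨b, hb, hp⟩ := hz.exists_cons hT'
        obtain ⟨k, hk, c, hc, hcr⟩ := pathDepth_le_iff.1 (h _ hp)
        rcases k with _ | k
        · cases hc; rw [hb, hcr] at hr; exact (hr rfl).elim
        · exact pathDepth_le_iff.2 ⟨k, by omega, c, by simpa using hc, hcr⟩

theorem depth_ne_top_iff {r : Part} {T : GType} (hr : r ∈ players T) :
    depth T r ≠ ⊤ ↔ ∃ n, ActsWithin r n T := by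
  simp only [actsWithin_iff, depth, if_pos hr]
  constructor
  · intro h
    obtain ⟨n, hn⟩ := ENat.ne_top_iff_exists.1 h
    exact ⟨n, fun xi hxi => hn ▸ le_sSup ⟨xi, hxi, rfl⟩⟩
  · rintro ⟨n, hn⟩
    refine ne_top_of_le_ne_top (ENat.natCast_ne_top n) (sSup_le ?_)
    rintro _ ⟨xi, hxi, rfl⟩
    exact hn xi hxi

theorem inactive_empty (T : GType) : Inactive T ∅ := by
  refine ⟨fun _ => True, fun T _ => ?_, trivial⟩
  rcases T.cases with rfl | ⟨p, I, hI, hp, G, rfl⟩ | ⟨p, I, hI, hp, G, rfl⟩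
  · exact .nil rfl
  · exact .out rfl (fun _ h => h) fun _ => trivial
  · exact .inp rfl fun _ => trivial

/-! ### Channels of a queue -/

/-- The labels of the messages from `s` to `r` in a queue, in their order. -/
def channel (s r : Part) (Q : Queue) : List Lab :=
  (Q.filter fun m => m.1 = s ∧ m.2.2 = r).map fun m => m.2.1

@[simp] theorem channel_nil (s r : Part) : channel s r [] = [] := rfl

theorem channel_append (s r : Part) (Q Q' : Queue) :
    channel s r (Q ++ Q') = channel s r Q ++ channel s r Q' := by
  simp [channel]

theorem channel_cons_self (s r : Part) (l : Lab) (Q : Queue) :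
    channel s r ((s, l, r) :: Q) = l :: channel s r Q := by
  simp [channel]

theorem channel_cons_of_ne {s r : Part} {m : Message} (h : m.1 ≠ s ∨ m.2.2 ≠ r) (Q : Queue) :
    channel s r (m :: Q) = channel s r Q := by
  unfold channel
  rw [List.filter_cons_of_neg]
  simpa [imp_iff_not_or] using h

theorem QueueEquiv.channel_eq {Q Q' : Queue} (h : QueueEquiv Q Q') (s r : Part) :
    channel s r Q = channel s r Q' := by
  induction h with
  | swap Q Q' m n hmn =>
    rw [channel_append, channel_append]
    congr 1
    by_cases hm : m.1 ≠ s ∨ m.2.2 ≠ r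
    · rw [channel_cons_of_ne hm, ← List.singleton_append, channel_append,
        ← List.singleton_append (x := n) (l := m :: Q'), channel_append, channel_cons_of_ne hm]
    · have hn : n.1 ≠ s ∨ n.2.2 ≠ r := by
        push Not at hm
        rw [hm.1, hm.2] at hmn
        exact hmn.imp Ne.symm Ne.symm
      rw [channel_cons_of_ne hn, ← List.singleton_append, channel_append, channel_cons_of_ne hn,
        ← List.singleton_append (x := m) (l := Q'), channel_append]
  | refl => rfl
  | symm _ ih => exact ih.symm
  | trans _ _ ih₁ ih₂ => exact ih₁.trans ih₂

/-- A message can be moved to the front past messages of other senders. -/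
theorem queueEquiv_append_singleton (Q : Queue) (m : Message) (h : ∀ n ∈ Q, n.1 ≠ m.1) :
    QueueEquiv (Q ++ [m]) (m :: Q) := by
  induction Q using List.reverseRecOn with
  | nil => exact .refl _
  | append_singleton Q n ih =>
    have hswap := QueueEquiv.swap Q [] n m (.inl (h n (by simp)))
    have hfront : ∀ {Q Q' : Queue} (R : Queue), QueueEquiv Q Q' →
        QueueEquiv (Q ++ R) (Q' ++ R) := by
      intro Q Q' R hQ
      induction hQ with
      | swap M M' m n h => simpa using QueueEquiv.swap M (M' ++ R) m n h
      | refl => exact .refl _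
      | symm _ ih => exact ih.symm
      | trans _ _ ih₁ ih₂ => exact ih₁.trans ih₂
    have := hfront [n] (ih fun k hk => h k (by simp [hk]))
    simp only [List.append_assoc, List.cons_append, List.nil_append] at this hswap ⊢
    exact hswap.trans this

end AsyncSession

namespace AsyncSession

/-! ### The session of a queue machine -/

open QueueMachine (Machine Instr Halts)

variable {St A : Type} [Encodable A]

/-- The label of a symbol; the label of `none` is used for messages that carry no symbol. -/
def label (x : Option A) : Lab := Encodable.encode x

theorem label_injective : Function.Injective (label : Option A → Lab) := Encodable.encode_injective

/-- Continue with `k a` if the label stands for the symbol `a`, and with `d` otherwise. -/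
def onSymbol {V : Type} (k : A → V) (d : V) (l : Lab) : V :=
  match (Encodable.decode l : Option (Option A)) with
  | some (some a) => k a
  | _ => d

@[simp] theorem onSymbol_some {V : Type} (k : A → V) (d : V) (a : A) :
    onSymbol k d (label (some a)) = k a := by
  rw [onSymbol, label, Encodable.encodek]

@[simp] theorem onSymbol_none {V : Type} (k : A → V) (d : V) :
    onSymbol k d (label (none : Option A)) = d := by
  rw [onSymbol, label, Encodable.encodek]

theorem onSymbol_eq_or {V : Type} (k : A → V) (d : V) (l : Lab) :
    (∃ a, onSymbol k d l = k a) ∨ onSymbol k d l = d := by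
  unfold onSymbol
  split
  exacts [.inl ⟨_, rfl⟩, .inr rfl]

/-- The single branch with partner `q` for `x`. -/
def oneBranch (q : Part) (x : Option A) : Branches := {(q, label x)}

theorem mem_oneBranch {q : Part} {x : Option A} {b : Part × Lab} :
    b ∈ oneBranch q x ↔ b = (q, label x) := Finset.mem_singleton

theorem ne_of_mem_oneBranch {p q : Part} {x : Option A} (h : p ≠ q) :
    ∀ b ∈ oneBranch q x, p ≠ b.1 := by
  rintro b hb
  obtain rfl := mem_oneBranch.1 hb
  exact h

theorem oneBranch_nonempty (q : Part) (x : Option A) : (oneBranch q x).Nonempty :=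
  Finset.singleton_nonempty _

section

variable (A) [Fintype A]

/-- A branch with partner `q` for each symbol. -/
def symbolBranches (q : Part) : Branches := Finset.univ.image fun a : A => (q, label (some a))

/-- A branch with partner `q` for each symbol and one for `none`. -/
def allBranches (q : Part) : Branches := Finset.univ.image fun x : Option A => (q, label x)

variable {A}

theorem mem_symbolBranches {q : Part} {b : Part × Lab} :
    b ∈ symbolBranches A q ↔ ∃ a : A, b = (q, label (some a)) := by
  simp [symbolBranches, eq_comm]

theorem mem_allBranches {q : Part} {b : Part × Lab} :
    b ∈ allBranches A q ↔ ∃ x : Option A, b = (q, label x) := by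
  simp [allBranches, eq_comm]

theorem ne_of_mem_symbolBranches {p q : Part} (h : p ≠ q) :
    ∀ b ∈ symbolBranches A q, p ≠ b.1 := by
  rintro b hb
  obtain ⟨a, rfl⟩ := mem_symbolBranches.1 hb
  exact h

theorem ne_of_mem_allBranches {p q : Part} (h : p ≠ q) : ∀ b ∈ allBranches A q, p ≠ b.1 := by
  rintro b hb
  obtain ⟨x, rfl⟩ := mem_allBranches.1 hb
  exact h

theorem fst_eq_of_mem_symbolBranches {q : Part} : ∀ b ∈ symbolBranches A q, b.1 = q := by
  intro b hb
  obtain ⟨a, rfl⟩ := mem_symbolBranches.1 hb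
  rfl

theorem fst_eq_of_mem_allBranches {q : Part} : ∀ b ∈ allBranches A q, b.1 = q := by
  intro b hb
  obtain ⟨x, rfl⟩ := mem_allBranches.1 hb
  rfl

theorem symbolBranches_nonempty [Nonempty A] (q : Part) : (symbolBranches A q).Nonempty :=
  Finset.univ_nonempty.image _

theorem allBranches_nonempty (q : Part) : (allBranches A q).Nonempty :=
  Finset.univ_nonempty.image _

end

/-- The states of the two processes. The controller (participant `0`) executes the instruction of
a state (`ctl`), and after a reading instruction sends a message without symbol (`ack`). The
forwarder (participant `1`) waits for a message (`idle`), and returns the symbol in it (`hold`). -/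
inductive ProcState (St A : Type) : Type
  | ctl (s : St) : ProcState St A
  | ack (s : St) : ProcState St A
  | idle : ProcState St A
  | hold (a : A) : ProcState St A

instance [Finite St] [Finite A] : Finite (ProcState St A) :=
  Finite.of_surjective (α := (St ⊕ St) ⊕ Option A)
    (Sum.elim (Sum.elim .ctl .ack) fun x => x.elim .idle .hold) <| by
      rintro (s | s | _ | a)
      exacts [⟨.inl (.inl s), rfl⟩, ⟨.inl (.inr s), rfl⟩, ⟨.inr none, rfl⟩, ⟨.inr (some a), rfl⟩]

/-- The states of the global type. Controller and forwarder alternate: the controller executes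
one instruction (`ctl`), followed by a message without symbol (`ack`) if the instruction was a
reading one, so that there is exactly one message for the forwarder to receive (`fwd`), which it
then returns if it carries a symbol (`hold`). -/
inductive GlobalState (St A : Type) : Type
  | ctl (s : St) : GlobalState St A
  | ack (s : St) : GlobalState St A
  | fwd (s : St) : GlobalState St A
  | hold (a : A) (s : St) : GlobalState St A

instance [Finite St] [Finite A] : Finite (GlobalState St A) :=
  Finite.of_surjective (α := (St ⊕ St) ⊕ Option A × St)
    (Sum.elim (Sum.elim .ctl .ack) fun x => x.1.elim (.fwd x.2) fun a => .hold a x.2) <| by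
      rintro (s | s | s | ⟨a, s⟩)
      exacts [⟨.inl (.inl s), rfl⟩, ⟨.inl (.inr s), rfl⟩, ⟨.inr (none, s), rfl⟩,
        ⟨.inr (some a, s), rfl⟩]

variable [Fintype A] [Nonempty A]

/-- The equations of the processes. The default of `onSymbol` is reached only by the message without
symbol in the state `idle`, as the branches of `ctl` are those for symbols. -/
def procEquations (M : Machine St A) : ProcState St A → procF (ProcState St A)
  | .ctl s => match M s with
    | .read f => ⟨.inp (symbolBranches A 1) (symbolBranches_nonempty 1),
        fun i => onSymbol (fun a => .ack (f a)) .idle i.1.2⟩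
    | .write a s' => ⟨.out (oneBranch 1 (some a)) (oneBranch_nonempty 1 _), fun _ => .ctl s'⟩
  | .ack s => ⟨.out (oneBranch 1 (none : Option A)) (oneBranch_nonempty 1 _), fun _ => .ctl s⟩
  | .idle => ⟨.inp (allBranches A 0) (allBranches_nonempty 0),
      fun i => onSymbol (fun a : A => .hold a) .idle i.1.2⟩
  | .hold a => ⟨.out (oneBranch 0 (some a)) (oneBranch_nonempty 0 _), fun _ => .idle⟩

/-- The equations of the global type, whose branches are those of the acting process. -/
def globalEquations (M : Machine St A) : GlobalState St A → globalF (GlobalState St A)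
  | .ctl s => match M s with
    | .read f => ⟨.inp 0 (symbolBranches A 1) (symbolBranches_nonempty 1)
          (ne_of_mem_symbolBranches zero_ne_one),
        fun i => onSymbol (fun a => .ack (f a)) (.fwd s) i.1.2⟩
    | .write a s' => ⟨.out 0 (oneBranch 1 (some a)) (oneBranch_nonempty 1 _)
          (ne_of_mem_oneBranch zero_ne_one),
        fun _ => .fwd s'⟩
  | .ack s => ⟨.out 0 (oneBranch 1 (none : Option A)) (oneBranch_nonempty 1 _)
      (ne_of_mem_oneBranch zero_ne_one), fun _ => .fwd s⟩
  | .fwd s => ⟨.inp 1 (allBranches A 0) (allBranches_nonempty 0)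
        (ne_of_mem_allBranches one_ne_zero),
      fun i => onSymbol (fun a : A => .hold a s) (.ctl s) i.1.2⟩
  | .hold a s => ⟨.out 1 (oneBranch 0 (some a)) (oneBranch_nonempty 0 _)
      (ne_of_mem_oneBranch one_ne_zero), fun _ => .ctl s⟩

/-- The process in a given state. -/
def process (M : Machine St A) : ProcState St A → Proc := PFunctor.M.corec (procEquations M)

/-- The global type in a given state. -/
def globalType (M : Machine St A) : GlobalState St A → GType :=
  PFunctor.M.corec (globalEquations M)

variable {M : Machine St A}

theorem process_ctl_read {s : St} {f : A → St} (h : M s = .read f) :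
    process M (.ctl s) = Proc.inp (symbolBranches A 1) (symbolBranches_nonempty 1)
      fun i => process M (onSymbol (fun a => .ack (f a)) .idle i.1.2) :=
  corec_eq_procInp (by simp only [procEquations, h]; rfl)

theorem process_ctl_write {s s' : St} {a : A} (h : M s = .write a s') :
    process M (.ctl s) = Proc.out (oneBranch 1 (some a)) (oneBranch_nonempty 1 _)
      fun _ => process M (.ctl s') :=
  corec_eq_procOut (by simp only [procEquations, h]; rfl)

theorem process_ack (s : St) :
    process M (.ack s) = Proc.out (oneBranch 1 (none : Option A)) (oneBranch_nonempty 1 _)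
      fun _ => process M (.ctl s) :=
  corec_eq_procOut rfl

theorem process_idle :
    process M .idle = Proc.inp (allBranches A 0) (allBranches_nonempty 0)
      fun i => process M (onSymbol (fun a : A => .hold a) .idle i.1.2) :=
  corec_eq_procInp rfl

theorem process_hold (a : A) :
    process M (.hold a) = Proc.out (oneBranch 0 (some a)) (oneBranch_nonempty 0 _)
      fun _ => process M .idle :=
  corec_eq_procOut rfl

theorem process_ne_nil (v : ProcState St A) : process M v ≠ Proc.nil := by
  rcases v with s | s | _ | a
  · rcases h : M s with f | ⟨a, s'⟩
    · rw [process_ctl_read h]; exact Proc.inp_ne_nil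
    · rw [process_ctl_write h]; exact Proc.out_ne_nil
  · rw [process_ack]; exact Proc.out_ne_nil
  · rw [process_idle]; exact Proc.inp_ne_nil
  · rw [process_hold]; exact Proc.out_ne_nil

/-- The network in which `0` runs `P` and `1` runs `P'`. -/
def network (P P' : Proc) : Net := fun r => if r = 0 then P else if r = 1 then P' else Proc.nil

@[simp] theorem network_zero (P P' : Proc) : network P P' 0 = P := rfl

@[simp] theorem network_one (P P' : Proc) : network P P' 1 = P' := rfl

theorem network_of_ne (P P' : Proc) {r : Part} (h0 : r ≠ 0) (h1 : r ≠ 1) :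
    network P P' r = Proc.nil := by
  simp [network, h0, h1]

@[simp] theorem update_network_zero (P P' P₁ : Proc) :
    Function.update (network P P') 0 P₁ = network P₁ P' := by
  funext r
  by_cases h0 : r = 0
  · subst h0; simp
  · simp [network, h0]

@[simp] theorem update_network_one (P P' P₁ : Proc) :
    Function.update (network P P') 1 P₁ = network P P₁ := by
  funext r
  by_cases h1 : r = 1
  · subst h1; simp
  · simp [network, h1]

theorem netPlayers_network {P P' : Proc} (hP : P ≠ Proc.nil) (hP' : P' ≠ Proc.nil) :
    netPlayers (network P P') = {0, 1} := by
  ext r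
  by_cases h0 : r = 0
  · subst h0; simpa [netPlayers] using hP
  · by_cases h1 : r = 1
    · subst h1; simpa [netPlayers] using hP'
    · simp [netPlayers, network, h0, h1]

/-- The message that carries the symbol `a` from the forwarder to the controller. -/
def symbolMessage (a : A) : Message := (1, label (some a), 0)

/-- The session of a queue machine started in state `s` with the queue `w`. -/
def machineSession [Finite St] (M : Machine St A) (s : St) (w : List A) : Session where
  net := network (process M (.ctl s)) (process M .idle)
  queue := w.map symbolMessage
  finite_players := by
    rw [netPlayers_network (process_ne_nil _) (process_ne_nil _)]
    exact Set.toFinite _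
  regular := by
    have hnil : Regular Proc.nil := by
      refine (Set.finite_singleton Proc.nil).subset fun P hP => ?_
      rcases Relation.ReflTransGen.cases_tail hP with h | ⟨P', -, ⟨b, -⟩⟩
      · exact h.symm
      · exact b.elim
    intro p
    unfold network
    split_ifs
    exacts [regular_corec _ _, regular_corec _ _, hnil]

/-! ### The global type of a queue machine -/

theorem globalType_ctl_read {s : St} {f : A → St} (h : M s = .read f) :
    globalType M (.ctl s) = GType.inp 0 (symbolBranches A 1) (symbolBranches_nonempty 1)
      (ne_of_mem_symbolBranches zero_ne_one)
      fun i => globalType M (onSymbol (fun a => .ack (f a)) (.fwd s) i.1.2) :=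
  corec_eq_globalInp (by simp only [globalEquations, h]; rfl)

theorem globalType_ctl_write {s s' : St} {a : A} (h : M s = .write a s') :
    globalType M (.ctl s) = GType.out 0 (oneBranch 1 (some a)) (oneBranch_nonempty 1 _)
      (ne_of_mem_oneBranch zero_ne_one) fun _ => globalType M (.fwd s') :=
  corec_eq_globalOut (by simp only [globalEquations, h]; rfl)

theorem globalType_ack (s : St) :
    globalType M (.ack s) = GType.out 0 (oneBranch 1 (none : Option A)) (oneBranch_nonempty 1 _)
      (ne_of_mem_oneBranch zero_ne_one) fun _ => globalType M (.fwd s) :=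
  corec_eq_globalOut rfl

theorem globalType_fwd (s : St) :
    globalType M (.fwd s) = GType.inp 1 (allBranches A 0) (allBranches_nonempty 0)
      (ne_of_mem_allBranches one_ne_zero)
      fun i => globalType M (onSymbol (fun a : A => .hold a s) (.ctl s) i.1.2) :=
  corec_eq_globalInp rfl

theorem globalType_hold (a : A) (s : St) :
    globalType M (.hold a s) = GType.out 1 (oneBranch 0 (some a)) (oneBranch_nonempty 0 _)
      (ne_of_mem_oneBranch one_ne_zero) fun _ => globalType M (.ctl s) :=
  corec_eq_globalOut rfl

theorem headPlayer_globalType (v : GlobalState St A) : headPlayer (globalType M v) =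
    some (match v with | .ctl _ => 0 | .ack _ => 0 | .fwd _ => 1 | .hold _ _ => 1) := by
  rcases v with s | s | s | ⟨a, s⟩
  · rcases h : M s with f | ⟨a, s'⟩
    · rw [globalType_ctl_read h]; rfl
    · rw [globalType_ctl_write h]; rfl
  · rfl
  · rfl
  · rfl

/-- The transitions of the global type, where the instruction in `ctl` is left open. -/
theorem isChild_globalType {v : GlobalState St A} {T : GType} : IsChild T (globalType M v) →
    match v with
    | .ctl _ => ∃ s', T = globalType M (.ack s') ∨ T = globalType M (.fwd s')
    | .ack s => T = globalType M (.fwd s)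
    | .fwd s => T = globalType M (.ctl s) ∨ ∃ a, T = globalType M (.hold a s)
    | .hold _ s => T = globalType M (.ctl s) := by
  intro hT
  rcases v with s | s | s | ⟨a, s⟩
  · rcases h : M s with f | ⟨a, s'⟩
    · rw [globalType_ctl_read h] at hT
      obtain ⟨i, rfl⟩ := isChild_inp.1 hT
      rcases onSymbol_eq_or (fun a => GlobalState.ack (f a)) (.fwd s) i.1.2 with ⟨a, h⟩ | h <;>
        rw [h]
      exacts [⟨_, .inl rfl⟩, ⟨_, .inr rfl⟩]
    · rw [globalType_ctl_write h] at hT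
      obtain ⟨i, rfl⟩ := isChild_out.1 hT
      exact ⟨_, .inr rfl⟩
  · rw [globalType_ack] at hT
    obtain ⟨i, rfl⟩ := isChild_out.1 hT
    rfl
  · rw [globalType_fwd] at hT
    obtain ⟨i, rfl⟩ := isChild_inp.1 hT
    rcases onSymbol_eq_or (fun a : A => GlobalState.hold a s) (.ctl s) i.1.2 with ⟨a, h⟩ | h <;>
      rw [h]
    exacts [.inr ⟨_, rfl⟩, .inl rfl]
  · rw [globalType_hold] at hT
    obtain ⟨i, rfl⟩ := isChild_out.1 hT
    rfl

theorem actsWithin_of_headPlayer {r : Part} {T : GType} (n : ℕ) (h : headPlayer T = some r) :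
    ActsWithin r (n + 1) T := .inl h

theorem actsWithin_zero (v : GlobalState St A) : ActsWithin 0 3 (globalType M v) := by
  have tail : ∀ (n : ℕ) (v : GlobalState St A),
      (∀ T, IsChild T (globalType M v) → ActsWithin 0 n T) →
        ActsWithin 0 (n + 1) (globalType M v) :=
    fun n v h => .inr ⟨by rw [headPlayer_globalType]; exact Option.some_ne_none _, h⟩
  have hctl : ∀ n s, ActsWithin 0 (n + 1) (globalType M (.ctl s)) :=
    fun n s => actsWithin_of_headPlayer n (headPlayer_globalType _)
  have hhold : ∀ n a s, ActsWithin 0 (n + 2) (globalType M (.hold a s)) := by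
    intro n a s
    refine tail _ _ fun T hT => ?_
    rw [show T = _ from isChild_globalType hT]
    exact hctl _ _
  rcases v with s | s | s | ⟨a, s⟩
  · exact hctl _ _
  · exact actsWithin_of_headPlayer _ (headPlayer_globalType _)
  · refine tail _ _ fun T hT => ?_
    rcases isChild_globalType hT with rfl | ⟨a, rfl⟩
    exacts [hctl _ _, hhold _ _ _]
  · exact hhold _ _ _

theorem actsWithin_one (v : GlobalState St A) : ActsWithin 1 3 (globalType M v) := by
  have tail : ∀ (n : ℕ) (v : GlobalState St A),
      (∀ T, IsChild T (globalType M v) → ActsWithin 1 n T) →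
        ActsWithin 1 (n + 1) (globalType M v) :=
    fun n v h => .inr ⟨by rw [headPlayer_globalType]; exact Option.some_ne_none _, h⟩
  have hfwd : ∀ n s, ActsWithin 1 (n + 1) (globalType M (.fwd s)) :=
    fun n s => actsWithin_of_headPlayer n (headPlayer_globalType _)
  have hack : ∀ n s, ActsWithin 1 (n + 2) (globalType M (.ack s)) := by
    intro n s
    refine tail _ _ fun T hT => ?_
    rw [show T = _ from isChild_globalType hT]
    exact hfwd _ _
  rcases v with s | s | s | ⟨a, s⟩
  · refine tail _ _ fun T hT => ?_
    obtain ⟨s', rfl | rfl⟩ := isChild_globalType hT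
    exacts [hack _ _, hfwd _ _]
  · exact hack _ _
  · exact hfwd _ _
  · exact actsWithin_of_headPlayer _ (headPlayer_globalType _)

theorem isPlayer_of_actsWithin {r : Part} {n : ℕ} {T : GType} (h : ActsWithin r n T) :
    IsPlayer r T := by
  induction n generalizing T with
  | zero => exact h.elim
  | succ n ih =>
    rcases h with h | ⟨hne, h⟩
    · exact isPlayer_of_headPlayer_eq h
    · rcases T.cases with rfl | ⟨p, I, ⟨x, hx⟩, hp, G, rfl⟩ | ⟨p, I, ⟨x, hx⟩, hp, G, rfl⟩
      · exact (hne rfl).elim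
      · exact (ih (h _ ⟨⟨x, hx⟩, rfl⟩)).of_isChild ⟨⟨x, hx⟩, rfl⟩
      · exact (ih (h _ ⟨⟨x, hx⟩, rfl⟩)).of_isChild ⟨⟨x, hx⟩, rfl⟩

theorem players_globalType (v : GlobalState St A) : players (globalType M v) = {0, 1} := by
  ext r
  constructor
  · intro h
    have key : ∀ T, IsPlayer r T → ∀ v, T = globalType M v → r = 0 ∨ r = 1 := by
      have head : ∀ v, headPlayer (globalType M v) = some r → r = 0 ∨ r = 1 := by
        intro v hv
        rw [headPlayer_globalType] at hv
        cases hv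
        cases v <;> simp
      have child : ∀ T v, IsChild T (globalType M v) → ∃ u, T = globalType M u := by
        intro T v hT
        obtain ⟨b, hb⟩ := isChild_corec.1 hT
        exact ⟨_, hb⟩
      intro T hT
      induction hT with
      | out_head hT => rintro v rfl; exact head v (by rw [hT]; rfl)
      | inp_head hT => rintro v rfl; exact head v (by rw [hT]; rfl)
      | out_tail hT i _ ih =>
        rintro v rfl
        obtain ⟨u, hu⟩ := child _ v (by rw [hT]; exact ⟨i, rfl⟩)
        exact ih u hu
      | inp_tail hT i _ ih =>
        rintro v rfl
        obtain ⟨u, hu⟩ := child _ v (by rw [hT]; exact ⟨i, rfl⟩)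
        exact ih u hu
    simpa using key _ h v rfl
  · rintro (rfl | rfl)
    exacts [isPlayer_of_actsWithin (actsWithin_zero v), isPlayer_of_actsWithin (actsWithin_one v)]

theorem bounded_globalType (v : GlobalState St A) : Bounded (globalType M v) := by
  intro r hr T hT
  obtain ⟨u, rfl⟩ := exists_of_subterm_corec hT
  change depth (globalType M u) r ≠ ⊤
  rw [players_globalType, ← players_globalType (M := M) u] at hr
  rw [depth_ne_top_iff hr]
  rw [players_globalType] at hr
  rcases hr with rfl | rfl
  exacts [⟨3, actsWithin_zero u⟩, ⟨3, actsWithin_one u⟩]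

end AsyncSession

namespace AsyncSession

open QueueMachine (Machine Instr Halts)

variable {St A : Type} [Encodable A] [Fintype A] [Nonempty A] {M : Machine St A}

/-! ### Typing the session of a machine that runs forever -/

theorem Ready.exists_channel_eq {s r : Part} {l : Lab} {Q : Queue} (h : Ready (s, l, r) Q) :
    ∃ t, channel s r Q = l :: t := by
  obtain ⟨Q', hQ⟩ := h
  exact ⟨_, (hQ.channel_eq s r).trans (channel_cons_self s r l Q')⟩

theorem awakening_eq_empty {p q : Part} {I H : Branches} {J : Set (Part × Lab)}
    (hI : ∀ x ∈ I, x.1 = q) (hH : ∀ x ∈ H, x.1 = q) (hJI : ∀ x ∈ J, x ∈ I) (hJ : J.Nonempty) :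
    awakening p I H J = ∅ := by
  refine Set.eq_empty_of_forall_notMem ?_
  rintro m ⟨x, hx, -, hne, -⟩
  obtain ⟨y, hy⟩ := hJ
  have hx' : x.1 = q := hx.elim (hI x) (hH x)
  exact hne y hy (hx'.trans (hI y (hJI y hy)).symm)

/-- An input choice in which all branches have the sender `q`, when the front message from `q` to
`p` has one of the expected labels. -/
theorem typingStep_inp {R : GType → Net → Queue → Prop} {N : Net} {Q Q' : Queue} {p q : Part}
    {l : Lab} {I : Branches} {hI hp} {G : I → GType} {P : I → Proc}
    (hIq : ∀ x ∈ I, x.1 = q) (hl : (q, l) ∈ I) (hQ : QueueEquiv Q ((q, l, p) :: Q'))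
    (hN : N p = Proc.inp I hI P)
    (prem : R (G ⟨(q, l), hl⟩) (Function.update N p (P ⟨(q, l), hl⟩)) Q')
    (hplay : ∀ i, players (G i) \ {p} = netPlayers N \ {p}) :
    TypingStep R (GType.inp p I hI hp G) N Q := by
  have hlive : ∀ x ∈ live p I Q, x = (q, l) := by
    rintro ⟨q', l'⟩ ⟨hx, hr⟩
    obtain rfl : q' = q := hIq _ hx
    obtain ⟨t, ht⟩ := hr.exists_channel_eq
    rw [hQ.channel_eq, channel_cons_self] at ht
    rw [(List.cons.inj ht).1]
  have hne : (live p I Q).Nonempty := ⟨(q, l), hl, Q', hQ⟩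
  refine .inRule rfl hN (live p I Q) rfl rfl hne (fun _ => Q') ?_ ?_ ?_ hplay
  · intro x hx
    rw [hlive x hx]
    exact hQ
  · intro x _ _ hx
    obtain rfl := hlive x hx
    exact prem
  · intro x _ _
    rw [awakening_eq_empty hIq hIq (fun x hx => hx.1) hne]
    exact inactive_empty _

/-- The judgements in the derivation for a machine that runs forever. -/
inductive Scheduled (M : Machine St A) : GType → Net → Queue → Prop
  | ctl (s : St) (w : List A) (h : ¬ Halts M s w) :
    Scheduled M (globalType M (.ctl s)) (network (process M (.ctl s)) (process M .idle))
      (w.map symbolMessage)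
  | ack (s : St) (w : List A) (h : ¬ Halts M s w) :
    Scheduled M (globalType M (.ack s)) (network (process M (.ack s)) (process M .idle))
      (w.map symbolMessage)
  | fwd (s : St) (w : List A) (x : Option A) (h : ¬ Halts M s (w ++ x.toList)) :
    Scheduled M (globalType M (.fwd s)) (network (process M (.ctl s)) (process M .idle))
      (w.map symbolMessage ++ [(0, label x, 1)])
  | hold (a : A) (s : St) (w : List A) (h : ¬ Halts M s (w ++ [a])) :
    Scheduled M (globalType M (.hold a s)) (network (process M (.ctl s)) (process M (.hold a)))
      (w.map symbolMessage)

theorem Scheduled.typingStep {T : GType} {N : Net} {Q : Queue} (h : Scheduled M T N Q) :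
    TypingStep (Scheduled M) T N Q := by
  have hplay : ∀ (p : Part) (g : GlobalState St A) (u v : ProcState St A),
      players (globalType M g) \ {p} = netPlayers (network (process M u) (process M v)) \ {p} := by
    intro p g u v
    rw [players_globalType, netPlayers_network (process_ne_nil u) (process_ne_nil v)]
  rcases h with ⟨s, w, h⟩ | ⟨s, w, h⟩ | ⟨s, w, x, h⟩ | ⟨a, s, w, h⟩
  · rcases hs : M s with f | ⟨a, s'⟩
    · rcases w with _ | ⟨a, w⟩
      · exact (h (QueueMachine.halts_of_step_eq_none (QueueMachine.step_read_nil hs))).elim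
      · rw [globalType_ctl_read hs]
        refine typingStep_inp (q := 1) (l := label (some a)) fst_eq_of_mem_symbolBranches
          (mem_symbolBranches.2 ⟨a, rfl⟩) (.refl _) (process_ctl_read hs) ?_
          fun i => hplay _ _ _ _
        rw [QueueMachine.halts_iff_of_step (QueueMachine.step_read hs a w)] at h
        simpa using Scheduled.ack (f a) w h
    · rw [globalType_ctl_write hs]
      refine .outRule rfl (process_ctl_write hs) ?_ fun i => hplay _ _ _ _
      rintro ⟨x, hx⟩
      obtain rfl := mem_oneBranch.1 hx
      rw [QueueMachine.halts_iff_of_step (QueueMachine.step_write hs w)] at h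
      simpa using Scheduled.fwd s' w (some a) h
  · rw [globalType_ack]
    refine .outRule rfl (process_ack s) ?_ fun i => hplay _ _ _ _
    rintro ⟨x, hx⟩
    obtain rfl := mem_oneBranch.1 hx
    simpa using Scheduled.fwd s w none (by simpa using h)
  · rw [globalType_fwd]
    refine typingStep_inp (q := 0) (l := label x) fst_eq_of_mem_allBranches
      (mem_allBranches.2 ⟨x, rfl⟩) (queueEquiv_append_singleton _ _ ?_) process_idle ?_
      fun i => hplay _ _ _ _
    · intro m hm
      obtain ⟨a, -, rfl⟩ := List.mem_map.1 hm
      exact one_ne_zero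
    · cases x with
      | none => simpa using Scheduled.ctl s w (by simpa using h)
      | some a => simpa using Scheduled.hold a s w h
  · rw [globalType_hold]
    refine .outRule rfl (process_hold a) ?_ fun i => hplay _ _ _ _
    rintro ⟨x, hx⟩
    obtain rfl := mem_oneBranch.1 hx
    simpa [symbolMessage] using Scheduled.ctl s (w ++ [a]) h

theorem hasType_of_not_halts [Finite St] {s : St} {w : List A} (h : ¬ Halts M s w) :
    HasType (globalType M (.ctl s)) (machineSession M s w) :=
  ⟨regular_corec _ _, bounded_globalType _, Scheduled M, fun _ _ _ h => h.typingStep,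
    .ctl s w h⟩

/-! ### A typable session belongs to a machine that runs forever -/

/-- The states of the forwarder, with the labels that it still has to return. -/
inductive Forwarder : ProcState St A → List Lab → Prop
  | idle : Forwarder .idle []
  | hold (a : A) : Forwarder (.hold a) [label (some a)]

/-- The controller is in state `v`, and the symbols on their way to it, those that the forwarder
has still to return included, are `w`. Steps of the forwarder preserve this, whatever their order
with respect to those of the controller. -/
def Controls (M : Machine St A) (v : ProcState St A) (w : List A) (N : Net) (Q : Queue) : Prop :=
  ∃ u t, Forwarder u t ∧ N = network (process M v) (process M u) ∧
    channel 1 0 Q ++ t ++ (channel 0 1 Q).filter (· ≠ label (none : Option A)) =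
      w.map fun a => label (some a)

section

variable {R : GType → Net → Queue → Prop} (hR : ∀ T N Q, R T N Q → TypingStep R T N Q)
  {T : GType} {v : ProcState St A} {w : List A} {N : Net} {Q : Queue}
include hR

/-- The players of the network are players of every global type derivable for it. -/
theorem isPlayer_of_mem_netPlayers {r : Part} (h : R T N Q) (hr : r ∈ netPlayers N) :
    IsPlayer r T := by
  have key : ∀ (p : Part) (T' : GType), headPlayer T = some p → IsChild T' T →
      players T' \ {p} = netPlayers N \ {p} → IsPlayer r T := by
    intro p T' hp hT' heq
    by_cases hrp : r = p
    · subst hrp; exact isPlayer_of_headPlayer_eq hp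
    · have : r ∈ players T' \ {p} := heq ▸ ⟨hr, hrp⟩
      exact IsPlayer.of_isChild this.1 hT'
  rcases hR _ _ _ h with ⟨rfl, hN, -⟩ | ⟨rfl, -, -, hplay⟩ |
    ⟨rfl, -, J, hJ, -, ⟨x, hx⟩, _, -, -, -, hplay⟩
  · exact (hr (hN r)).elim
  · rename_i I hI hp G P
    obtain ⟨x, hx⟩ := hI
    exact key _ _ rfl ⟨⟨x, hx⟩, rfl⟩ (hplay ⟨x, hx⟩)
  · subst hJ
    exact key _ _ rfl ⟨⟨x, hx.1⟩, rfl⟩ (hplay ⟨x, hx.1⟩)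

/-- If the participant `r` runs an output choice and heads the global type, then it can send each
of its messages. -/
theorem exists_of_out {r : Part} {I : Branches} {hI} {P : I → Proc} (h : R T N Q)
    (hT : headPlayer T = some r) (hN : N r = Proc.out I hI P) (i : I) :
    ∃ T', IsChild T' T ∧ R T' (Function.update N r (P i)) (Q ++ [(r, i.1.2, i.1.1)]) := by
  rcases hR _ _ _ h with ⟨rfl, -, -⟩ | ⟨rfl, hN', prem, -⟩ | ⟨rfl, hN', -⟩
  · cases hT
  · cases hT
    obtain ⟨rfl, hP⟩ := Proc.out_inj (hN.symm.trans hN')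
    rw [hP _ i.2 i.2]
    exact ⟨_, ⟨i, rfl⟩, prem i⟩
  · cases hT
    exact (Proc.out_ne_inp (hN.symm.trans hN')).elim

/-- If the participant `r` runs an input choice and heads the global type, then it can receive one
of the messages that it expects. -/
theorem exists_of_inp {r : Part} {H : Branches} {hH} {P : H → Proc} (h : R T N Q)
    (hT : headPlayer T = some r) (hN : N r = Proc.inp H hH P) :
    ∃ T' i Q', IsChild T' T ∧ QueueEquiv Q ((i.1.1, i.1.2, r) :: Q') ∧
      R T' (Function.update N r (P i)) Q' := by
  rcases hR _ _ _ h with ⟨rfl, -, -⟩ | ⟨rfl, hN', -, -⟩ |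
    ⟨rfl, hN', J, hJ, hJH, ⟨x, hx⟩, Q', hQ, prem, -, -⟩
  · cases hT
  · cases hT
    exact (Proc.out_ne_inp (hN'.symm.trans hN)).elim
  · cases hT
    obtain ⟨rfl, hP⟩ := Proc.inp_inj (hN.symm.trans hN')
    have hxI : x ∈ live _ _ Q := hJ ▸ hx
    have hxH : x ∈ live _ _ Q := hJH ▸ hx
    refine ⟨_, ⟨x, hxH.1⟩, Q' x, ⟨⟨x, hxI.1⟩, rfl⟩, hQ x hx, ?_⟩
    rw [hP _ hxH.1 hxH.1]
    exact prem x hxI.1 hxH.1 hx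

theorem headPlayer_eq_of_controls (h : R T N Q) (hC : Controls M v w N Q) :
    headPlayer T = some 0 ∨ headPlayer T = some 1 := by
  obtain ⟨u, t, -, rfl, -⟩ := hC
  have key : ∀ p, network (process M v) (process M u) p ≠ Proc.nil → p = 0 ∨ p = 1 := by
    intro p hp
    by_contra hcon
    push Not at hcon
    exact hp (network_of_ne _ _ hcon.1 hcon.2)
  rcases hR _ _ _ h with ⟨-, hN, -⟩ | ⟨rfl, hN, -⟩ | ⟨rfl, hN, -⟩
  · exact (process_ne_nil v (hN 0)).elim
  · exact (key _ (hN ▸ Proc.out_ne_nil)).imp (congrArg some) (congrArg some)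
  · exact (key _ (hN ▸ Proc.inp_ne_nil)).imp (congrArg some) (congrArg some)

/-- The forwarder acts without changing the symbols on their way to the controller. -/
theorem exists_of_forwarder (h : R T N Q) (hC : Controls M v w N Q) (hT : headPlayer T = some 1) :
    ∃ T' N' Q', IsChild T' T ∧ R T' N' Q' ∧ Controls M v w N' Q' := by
  obtain ⟨u, t, hu, rfl, hw⟩ := hC
  cases hu with
  | idle =>
    obtain ⟨T', ⟨i, hi⟩, Q', hT', hQ, h'⟩ := exists_of_inp hR h hT process_idle
    obtain ⟨x, rfl⟩ := mem_allBranches.1 hi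
    rw [hQ.channel_eq, hQ.channel_eq, channel_cons_self,
      channel_cons_of_ne (.inl zero_ne_one)] at hw
    rw [update_network_one] at h'
    cases x with
    | none =>
      rw [onSymbol_none] at h'
      exact ⟨T', _, Q', hT', h', _, _, .idle, rfl, by simpa using hw⟩
    | some a =>
      rw [onSymbol_some] at h'
      have hne : label (some a) ≠ label (none : Option A) := fun h => by
        cases label_injective h
      exact ⟨T', _, Q', hT', h', _, _, .hold a, rfl, by simpa [hne] using hw⟩
  | hold a =>
    obtain ⟨T', hT', h'⟩ := exists_of_out hR h hT (process_hold a) ⟨_, mem_oneBranch.2 rfl⟩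
    rw [update_network_one] at h'
    refine ⟨T', _, _, hT', h', _, _, .idle, rfl, ?_⟩
    rw [channel_append, channel_append, channel_cons_self,
      channel_cons_of_ne (.inl one_ne_zero)]
    simpa using hw

/-- As the controller acts within a bounded number of steps, its turn comes. -/
theorem exists_headPlayer_eq_zero {n : ℕ} (hn : ActsWithin 0 n T) (h : R T N Q)
    (hC : Controls M v w N Q) :
    ∃ T' N' Q', Subterm T' T ∧ headPlayer T' = some 0 ∧ R T' N' Q' ∧ Controls M v w N' Q' := by
  induction n generalizing T N Q with
  | zero => exact hn.elim
  | succ n ih =>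
    rcases headPlayer_eq_of_controls hR h hC with h0 | h1
    · exact ⟨T, N, Q, .refl, h0, h, hC⟩
    · rcases hn with h0 | ⟨-, hn⟩
      · exact ⟨T, N, Q, .refl, h0, h, hC⟩
      · obtain ⟨T₁, N₁, Q₁, hT₁, h₁, hC₁⟩ := exists_of_forwarder hR h hC h1
        obtain ⟨T', N', Q', hT', h'⟩ := ih (hn T₁ hT₁) h₁ hC₁
        exact ⟨T', N', Q', hT'.tail hT₁, h'⟩

theorem exists_of_ack {s : St} (h : R T N Q) (hC : Controls M (.ack s) w N Q)
    (hT : headPlayer T = some 0) :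
    ∃ T' N' Q', IsChild T' T ∧ R T' N' Q' ∧ Controls M (.ctl s) w N' Q' := by
  obtain ⟨u, t, hu, rfl, hw⟩ := hC
  obtain ⟨T', hT', h'⟩ := exists_of_out hR h hT (process_ack s) ⟨_, mem_oneBranch.2 rfl⟩
  rw [update_network_zero] at h'
  refine ⟨T', _, _, hT', h', u, t, hu, rfl, ?_⟩
  rw [channel_append, channel_append, channel_cons_self, channel_cons_of_ne (.inl zero_ne_one)]
  simpa using hw

/-- An action of the controller in the state `ctl s` is a step of the machine; in particular the
machine has not halted. -/
theorem exists_of_ctl {s : St} (h : R T N Q) (hC : Controls M (.ctl s) w N Q)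
    (hT : headPlayer T = some 0) :
    ∃ s' w' T' N' Q', QueueMachine.step M (s, w) = some (s', w') ∧ IsChild T' T ∧ R T' N' Q' ∧
      (Controls M (.ack s') w' N' Q' ∨ Controls M (.ctl s') w' N' Q') := by
  obtain ⟨u, t, hu, rfl, hw⟩ := hC
  rcases hs : M s with f | ⟨a, s'⟩
  · obtain ⟨T', ⟨i, hi⟩, Q', hT', hQ, h'⟩ := exists_of_inp hR h hT (process_ctl_read hs)
    obtain ⟨a, rfl⟩ := mem_symbolBranches.1 hi
    rw [hQ.channel_eq, hQ.channel_eq, channel_cons_self,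
      channel_cons_of_ne (.inl one_ne_zero)] at hw
    rw [update_network_zero, onSymbol_some] at h'
    cases w with
    | nil => simp at hw
    | cons b w =>
      simp only [List.cons_append, List.map_cons, List.cons.injEq] at hw
      obtain rfl : a = b := Option.some_injective _ (label_injective hw.1)
      exact ⟨_, _, T', _, Q', QueueMachine.step_read hs a w, hT', h', .inl ⟨u, t, hu, rfl, hw.2⟩⟩
  · obtain ⟨T', hT', h'⟩ :=
      exists_of_out hR h hT (process_ctl_write hs) ⟨_, mem_oneBranch.2 rfl⟩
    rw [update_network_zero] at h'
    refine ⟨_, _, T', _, _, QueueMachine.step_write hs w, hT', h', .inr ⟨u, t, hu, rfl, ?_⟩⟩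
    have hne : label (some a) ≠ label (none : Option A) := fun h => by
      cases label_injective h
    rw [channel_append, channel_append, channel_cons_self, channel_cons_of_ne (.inl zero_ne_one)]
    simp only [channel_nil, List.append_nil, List.filter_append, List.map_append, ← hw]
    simp [hne]

end

theorem not_halts_of_hasType [Finite St] {s : St} {w : List A} {T₀ : GType}
    (hT₀ : HasType T₀ (machineSession M s w)) : ¬ Halts M s w := by
  obtain ⟨-, hB, R, hR, h₀⟩ := hT₀
  have hnet : ∀ {v w N Q}, Controls M v w N Q → 0 ∈ netPlayers N := by
    rintro v w _ Q ⟨u, t, -, rfl, -⟩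
    exact process_ne_nil v
  have hC₀ : Controls M (.ctl s) w (machineSession M s w).net (machineSession M s w).queue := by
    have h10 : ∀ w : List A, channel 1 0 (w.map symbolMessage) = w.map fun a => label (some a) := by
      intro w
      induction w with
      | nil => rfl
      | cons a w ih => simpa [symbolMessage, channel_cons_self] using ih
    have h01 : ∀ w : List A, channel 0 1 (w.map symbolMessage) = [] := by
      intro w
      induction w with
      | nil => rfl
      | cons a w ih =>
        rw [List.map_cons, channel_cons_of_ne (.inl one_ne_zero), ih]
    exact ⟨_, _, .idle, rfl, by simp [machineSession, h10, h01]⟩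
  -- Boundedness of `T₀` bounds the delay of the controller in every subterm of `T₀`.
  have turn : ∀ {T N Q v w}, Subterm T T₀ → R T N Q → Controls M v w N Q →
      ∃ T' N' Q', Subterm T' T₀ ∧ headPlayer T' = some 0 ∧ R T' N' Q' ∧ Controls M v w N' Q' := by
    intro T N Q v w hT h hC
    have hdepth := hB 0 (isPlayer_of_mem_netPlayers hR h₀ (hnet hC₀)) T hT
    obtain ⟨n, hn⟩ := (depth_ne_top_iff (isPlayer_of_mem_netPlayers hR h (hnet hC))).1 hdepth
    obtain ⟨T', N', Q', hT', h'⟩ := exists_headPlayer_eq_zero hR hn h hC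
    exact ⟨T', N', Q', hT'.trans hT, h'⟩
  intro hhalt
  obtain ⟨c, hc⟩ := Part.dom_iff_mem.1 hhalt
  suffices key : ∀ d : St × List A, c ∈ StateTransition.eval (QueueMachine.step M) d →
      ∀ T N Q, Subterm T T₀ → R T N Q → Controls M (.ctl d.1) d.2 N Q → False from
    key (s, w) hc _ _ _ .refl h₀ hC₀
  -- By induction on the length of the halting run: the controller always has a next step to make.
  intro d hd
  refine StateTransition.evalInduction hd fun d _ ih T N Q hT h hC => ?_
  obtain ⟨T₁, N₁, Q₁, hT₁, h0, h₁, hC₁⟩ := turn hT h hC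
  obtain ⟨s', w', T₂, N₂, Q₂, hstep, hT₂, h₂, hC₂ | hC₂⟩ := exists_of_ctl hR h₁ hC₁ h0
  · obtain ⟨T₃, N₃, Q₃, hT₃, h0', h₃, hC₃⟩ := turn (.head hT₂ hT₁) h₂ hC₂
    obtain ⟨T₄, N₄, Q₄, hT₄, h₄, hC₄⟩ := exists_of_ack hR h₃ hC₃ h0'
    exact ih _ hstep T₄ N₄ Q₄ (.head hT₄ hT₃) h₄ hC₄
  · exact ih _ hstep T₂ N₂ Q₂ (.head hT₂ hT₁) h₂ hC₂

end AsyncSession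

namespace AsyncSession

/-! ### The reduction -/

open QueueMachine (Machine Halts)

/-- Sessions of one machine have codes that differ only in the queue. -/
theorem exists_presentsSession {St A : Type} [Finite St] [Encodable A] [Fintype A] [Nonempty A]
    (M : Machine St A) (s : St) :
    ∃ (E : List ProcRhs) (located : List (Part × ℕ)), ∀ w : List A,
      PresentsSession (E, located, w.map symbolMessage) (machineSession M s w) := by
  obtain ⟨E, index, X, hE, hX⟩ := exists_procSolves (procEquations M)
  refine ⟨E, [(0, index (.ctl s)), (1, index .idle)], fun w => ⟨X, hE, by simp, ?_, ?_, rfl⟩⟩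
  · intro e he
    simp only [List.mem_cons, List.not_mem_nil, or_false] at he
    rcases he with rfl | rfl
    exacts [⟨(hX _).1, (hX _).2.symm⟩, ⟨(hX _).1, (hX _).2.symm⟩]
  · intro p hp
    simp only [List.map_cons, List.map_nil, List.mem_cons, List.not_mem_nil, or_false,
      not_or] at hp
    exact network_of_ne _ _ hp.1 hp.2

theorem exists_presentsGType {St A : Type} [Finite St] [Encodable A] [Fintype A] [Nonempty A]
    (M : Machine St A) (v : GlobalState St A) : ∃ g : GCode, PresentsGType g (globalType M v) := by
  obtain ⟨E, index, X, hE, hX⟩ := exists_gSolves (globalEquations M)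
  exact ⟨(E, index v), X, hE, (hX v).1, (hX v).2.symm⟩

end AsyncSession

open AsyncSession
/-- Typing is undecidable: no algorithm decides, given a finite presentation of a session,
whether the session is typable; and no algorithm decides, given finite presentations of a bounded
global type and of a session, whether the session has that type. -/
theorem theorem4 :
    (¬ ∃ f : SessionCode → Bool, Computable f ∧
      ∀ (c : SessionCode) (S : Session), PresentsSession c S →
        (f c = true ↔ Typable S)) ∧
    (¬ ∃ f : GCode × SessionCode → Bool, Computable f ∧
      ∀ (g : GCode) (c : SessionCode) (T : GType) (S : Session),
        PresentsGType g T → Bounded T → PresentsSession c S →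
          (f (g, c) = true ↔ HasType T S)) := by
  let _ : Encodable Turing.PartrecToTM2.Γ' := Fintype.toEncodable _
  obtain ⟨St, hSt, M, s, input, hinput, hM⟩ := QueueMachine.exists_undecidable_machine
  obtain ⟨E, located, hcode⟩ := exists_presentsSession M s
  have hcomp : Computable fun n =>
      ((E, located, (input n).map symbolMessage) : SessionCode) :=
    (Computable.const E).pair ((Computable.const located).pair (hinput symbolMessage))
  constructor
  · rintro ⟨f, hf, h⟩
    refine hM ⟨_, hf.comp hcomp, fun n => (h _ _ (hcode (input n))).trans ?_⟩
    exact ⟨fun ⟨_, hT⟩ => not_halts_of_hasType hT, fun hn => ⟨_, hasType_of_not_halts hn⟩⟩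
  · rintro ⟨f, hf, h⟩
    obtain ⟨g, hg⟩ := exists_presentsGType M (.ctl s)
    refine hM ⟨_, hf.comp ((Computable.const g).pair hcomp), fun n =>
      (h _ _ _ _ hg (bounded_globalType _) (hcode (input n))).trans ?_⟩
    exact ⟨not_halts_of_hasType, hasType_of_not_halts⟩
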